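/- Let $(V,g)$ be a finite-dimensional real vector space with a positive definite metric, and let $\mathcal T=\{K\in \mathrm{End}\,V : K^2=-\mathbb 1,\ g(K\cdot,K\cdot)=g(\cdot,\cdot)\}$, a submanifold of $\mathrm{End}\,V$ with $T_K\mathcal T=\mathfrak o_{\{K\}}:=\{A\in\mathfrak o(V,g) : AK+KA=0\}$. Let $\phi$ be the section of $\mathrm{End}\,V\times\mathcal T$ with $\phi|_K=K$, write $\{A,B\}=AB+BA$ and $[A,B]=AB-BA$, fix $J\in\mathcal T$, and let $\mathfrak u(J)=\{B\in\mathfrak o(V,g):[B,J]=0\}$. For a section $F:\mathcal T\to \mathrm{End}\,V$ define, at each $K\in\mathcal T$, \[\mathcal D^F|_K=\{B\in\mathfrak o_{\{K\}} : B(\mathrm{Ker}\,F_K)=0,\ B(\mathrm{Im}\,F_K)\subset \mathrm{Im}\,F_K\},\] \[\mathcal D^F_{\mathfrak u(J)}|_K=\{[B,K] : B\in\mathfrak u(J),\ B(\mathrm{Ker}\,F_K)=0,\ B(\mathrm{Im}\,F_K)\subset \mathrm{Im}\,F_K\}.\] These distributions may have varying rank; such a distribution $\mathcal D$ is called integrable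 if it is smooth (each of its vectors extends to a smooth vector field with values in $\mathcal D$) and through every point of $\mathcal T$ there passes an integral manifold, that is, an immersed submanifold whose tangent space at each of its points is the fibre of $\mathcal D$ there. Its leaves are the maximal connected integral manifolds. Let $S\in\{\mathbb 1,\ J+\phi,\ J-\phi,\ [J,\phi]\}$. (A) Let $Q:\mathcal T\to\mathrm{End}\,V$ be smooth with $Q^*=Q$, $[Q,J]=0$ and $[Q,\phi]=0$. 1) $\mathcal D^{QS}$ is integrable if $dQ_{QBQ}=Q(dQ_B)Q$ for all $B\in\mathcal D^S$. 2) $\mathcal D^{QS}_{\mathfrak u(J)}$ is integrable if $dQ_{QCQ}=Q(dQ_C)Q$ for all $C\in\mathcal D^S_{\mathfrak u(J)}$. (B) Let $Q=a_k\{J,\phi\}^k+\dots+a_1\{J,\phi\}+a_0\mathbb 1$ with $a_i\in C^\infty(\mathcal T)$. 1) $\mathcal D^{QS}$ is integrable if $d{a_i}_B=0$ for all $i$ and all $B\in\mathcal D^S$. 2) $\mathcal D^{QS}_{\mathfrak u(J)}$ is integrable if $d{a_i}_C=0$ for all $i$ and all $C\in\mathcal D^S_{\mathfrak u(J)}$.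 (C) $\mathcal D^S$ and $\mathcal D^S_{\mathfrak u(J)}$ are integrable, and, for $Q$ as in (B), $\mathcal D^{QS}$ (respectively $\mathcal D^{QS}_{\mathfrak u(J)}$) is integrable if each $a_i$ is constant along the leaves of $\mathcal D^S$ (respectively of $\mathcal D^S_{\mathfrak u(J)}$). -/

import Mathlib

open scoped ContDiff

/-! ### Singular distributions on a submanifold of a normed space -/

section Distributions

variable {E : Type*} [NormedAddCommGroup E] [NormedSpace ℝ E]

/-- `f : U → M`, with `U ⊆ ℝᵈ` open and connected, is an injective immersion whose image is an
integral manifold of `D`: the tangent space of the image at each of its points `x` is `D x`. -/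
structure IsIntegralPatch (M : Set E) (D : E → Submodule ℝ E) {d : ℕ}
    (U : Set (EuclideanSpace ℝ (Fin d))) (f : EuclideanSpace ℝ (Fin d) → E) : Prop where
  isOpen : IsOpen U
  isConnected : IsConnected U
  contDiffOn : ContDiffOn ℝ ∞ f U
  mapsTo : Set.MapsTo f U M
  injOn : Set.InjOn f U
  immersion : ∀ u ∈ U, Function.Injective (fderiv ℝ f u)
  tangent : ∀ u ∈ U, (fderiv ℝ f u).range = D (f u)

/-- `D`, possibly of varying rank, is smooth: every vector of `D` is the value of a smooth
vector field with values in `D`. -/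
def IsSmoothDistribution (M : Set E) (D : E → Submodule ℝ E) : Prop :=
  ∀ x ∈ M, ∀ v ∈ D x, ∃ X : E → E,
    ContDiffOn ℝ ∞ X M ∧ (∀ y ∈ M, X y ∈ D y) ∧ X x = v

/-- Integrability of a distribution of possibly varying rank (in the sense of Stefan and Sussmann):
it is smooth and through every point of `M` there passes an integral manifold. -/
def IsIntegrableDistribution (M : Set E) (D : E → Submodule ℝ E) : Prop :=
  IsSmoothDistribution M D ∧
    ∀ x ∈ M, ∃ (d : ℕ) (U : Set (EuclideanSpace ℝ (Fin d))) (f : EuclideanSpace ℝ (Fin d) → E),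
      IsIntegralPatch M D U f ∧ x ∈ f '' U

/-- The leaf of `D` through `x`: the points that can be joined to `x` by a finite chain of
connected integral manifolds of `D`. -/
def leafThrough (M : Set E) (D : E → Submodule ℝ E) (x : E) : Set E :=
  {y | Relation.EqvGen (fun p q : E =>
    ∃ (d : ℕ) (U : Set (EuclideanSpace ℝ (Fin d))) (f : EuclideanSpace ℝ (Fin d) → E),
      IsIntegralPatch M D U f ∧ p ∈ f '' U ∧ q ∈ f '' U) x y}

def ConstantAlongLeaves (M : Set E) (D : E → Submodule ℝ E) (a : E → ℝ) : Prop :=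
  ∀ x ∈ M, ∀ y ∈ leafThrough M D x, a y = a x

end Distributions

/-! ### The twistor space and its distributions -/

section Twistor

variable {V : Type*} [NormedAddCommGroup V] [InnerProductSpace ℝ V]

variable (V) in
/-- The orthogonal complex structures on `V`, as a submanifold of `End V`. -/
def twistorSpace : Set (V →L[ℝ] V) :=
  {K | K * K = -1 ∧ ∀ v w : V, inner ℝ (K v) (K w) = inner ℝ v w}

variable (V) in
/-- The Lie algebra `𝔬(V, g)` of skew-adjoint endomorphisms. -/
def skewEnd : Submodule ℝ (V →L[ℝ] V) where
  carrier := {A | ∀ v w : V, inner ℝ (A v) w = -inner ℝ v (A w)}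
  zero_mem' := by intro v w; simp
  add_mem' := by
    intro A B hA hB v w
    have h1 := hA v w
    have h2 := hB v w
    simp only [ContinuousLinearMap.add_apply, inner_add_left, inner_add_right, h1, h2]
    ring
  smul_mem' := by
    intro c A hA v w
    have h1 := hA v w
    simp only [ContinuousLinearMap.smul_apply, real_inner_smul_left, real_inner_smul_right, h1]
    ring

/-- `{A, B} = AB + BA`. -/
def antiComm (A B : V →L[ℝ] V) : V →L[ℝ] V := A * B + B * A

/-- The skew endomorphisms that anticommute with `K`; for `K` in the twistor space this is the
tangent space of the twistor space at `K`. -/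
def skewAnti (K : V →L[ℝ] V) : Submodule ℝ (V →L[ℝ] V) where
  carrier := {A | A ∈ skewEnd V ∧ antiComm A K = 0}
  zero_mem' := ⟨zero_mem _, by simp [antiComm]⟩
  add_mem' := by
    rintro A B ⟨hA, hA'⟩ ⟨hB, hB'⟩
    refine ⟨add_mem hA hB, ?_⟩
    have h : antiComm (A + B) K = antiComm A K + antiComm B K := by
      simp only [antiComm, add_mul, mul_add]; abel
    rw [h, hA', hB', add_zero]
  smul_mem' := by
    rintro c A ⟨hA, hA'⟩
    refine ⟨Submodule.smul_mem _ c hA, ?_⟩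
    have h : antiComm (c • A) K = c • antiComm A K := by
      simp only [antiComm, smul_mul_assoc, mul_smul_comm, smul_add]
    rw [h, hA', smul_zero]

/-- The map `B ↦ [B, K] = BK - KB`. -/
def commWith (K : V →L[ℝ] V) : (V →L[ℝ] V) →ₗ[ℝ] (V →L[ℝ] V) where
  toFun B := B * K - K * B
  map_add' A B := by simp only [add_mul, mul_add]; abel
  map_smul' c A := by
    simp only [smul_mul_assoc, mul_smul_comm, smul_sub, RingHom.id_apply]

/-- `𝔲(V, J)`: the skew endomorphisms that commute with `J`. -/
def unitaryAlg (J : V →L[ℝ] V) : Submodule ℝ (V →L[ℝ] V) :=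
  skewEnd V ⊓ LinearMap.ker (commWith J)

/-- The endomorphisms `B` with `B : Ker F → 0` and `B : Im F → Im F`. -/
def kerZeroImStable (F : V →L[ℝ] V) : Submodule ℝ (V →L[ℝ] V) where
  carrier := {B | (∀ v : V, F v = 0 → B v = 0) ∧ ∀ v : V, ∃ w : V, B (F v) = F w}
  zero_mem' := ⟨fun _ _ => rfl, fun _ => ⟨0, by simp⟩⟩
  add_mem' := by
    rintro A B ⟨hA, hA'⟩ ⟨hB, hB'⟩
    refine ⟨fun v hv => by simp [hA v hv, hB v hv], fun v => ?_⟩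
    obtain ⟨w, hw⟩ := hA' v
    obtain ⟨w', hw'⟩ := hB' v
    exact ⟨w + w', by simp [hw, hw']⟩
  smul_mem' := by
    rintro c A ⟨hA, hA'⟩
    refine ⟨fun v hv => by simp [hA v hv], fun v => ?_⟩
    obtain ⟨w, hw⟩ := hA' v
    exact ⟨c • w, by simp [hw]⟩

/-- The distribution `𝒟^F`, for a section `F` of `End V` over the twistor space. -/
def distF (F : (V →L[ℝ] V) → (V →L[ℝ] V)) (K : V →L[ℝ] V) : Submodule ℝ (V →L[ℝ] V) :=
  skewAnti K ⊓ kerZeroImStable (F K)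

/-- The distribution `𝒟^F_{𝔲(J)}`: at `K` it consists of the `[B, K]` with `B ∈ 𝔲(V, J)`,
`B : Ker F → 0` and `B : Im F → Im F`. (Such brackets always lie in `skewAnti K`.) -/
def distU (J : V →L[ℝ] V) (F : (V →L[ℝ] V) → (V →L[ℝ] V)) (K : V →L[ℝ] V) :
    Submodule ℝ (V →L[ℝ] V) :=
  (unitaryAlg J ⊓ kerZeroImStable (F K)).map (commWith K)

/-- The four sections `1`, `J + φ`, `J - φ`, `[J, φ]`, where `φ` is the section `φ|_K = K`. -/
def basicSections (J : V →L[ℝ] V) : Set ((V →L[ℝ] V) → (V →L[ℝ] V)) :=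
  {fun _ => 1, fun K => J + K, fun K => J - K, fun K => J * K - K * J}

/-- Smoothness of a map on the twistor space; only its values there matter. -/
def SmoothOnTwistor {W : Type*} [NormedAddCommGroup W] [NormedSpace ℝ W]
    (f : (V →L[ℝ] V) → W) : Prop :=
  ContDiffOn ℝ ∞ f (twistorSpace V)

/-- The derivative `df_B` at `K` of a map on the twistor space. For smooth `f` and `B` tangent to
the twistor space at `K` it is the usual one, determined by the values of `f` on the twistor
space (`B` is then the velocity of a curve in the twistor space). -/
noncomputable def dTwistor {W : Type*} [NormedAddCommGroup W] [NormedSpace ℝ W]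
    (f : (V →L[ℝ] V) → W) (K B : V →L[ℝ] V) : W :=
  fderivWithin ℝ f (twistorSpace V) K B

/-- `Q` is a smooth section with `Q* = Q`, `[Q, J] = 0` and `[Q, φ] = 0`. -/
structure IsAdmissible (J : V →L[ℝ] V) (Q : (V →L[ℝ] V) → (V →L[ℝ] V)) : Prop where
  smooth : SmoothOnTwistor Q
  selfAdjoint : ∀ K ∈ twistorSpace V, ∀ v w : V, inner ℝ (Q K v) w = inner ℝ v (Q K w)
  comm_J : ∀ K ∈ twistorSpace V, Q K * J = J * Q K
  comm_phi : ∀ K ∈ twistorSpace V, Q K * K = K * Q K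

/-- `dQ_{QBQ} = Q (dQ_B) Q` for all `B ∈ D`. -/
def QCondition (Q : (V →L[ℝ] V) → (V →L[ℝ] V))
    (D : (V →L[ℝ] V) → Submodule ℝ (V →L[ℝ] V)) : Prop :=
  ∀ K ∈ twistorSpace V, ∀ B ∈ D K,
    dTwistor Q K (Q K * B * Q K) = Q K * dTwistor Q K B * Q K

/-- `da_B = 0` for all `B ∈ D`. -/
def AnnihilatedAlong (a : (V →L[ℝ] V) → ℝ)
    (D : (V →L[ℝ] V) → Submodule ℝ (V →L[ℝ] V)) : Prop :=
  ∀ K ∈ twistorSpace V, ∀ B ∈ D K, dTwistor a K B = 0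

/-- `Q = a_k {J, φ}^k + ... + a_1 {J, φ} + a_0 1`. -/
noncomputable def polyQ (J : V →L[ℝ] V) {k : ℕ} (a : Fin (k + 1) → (V →L[ℝ] V) → ℝ)
    (K : V →L[ℝ] V) : V →L[ℝ] V :=
  ∑ i : Fin (k + 1), a i K • antiComm J K ^ (i : ℕ)

end Twistor

/-! ### Integral manifolds of involutive families of vector fields -/

section Frobenius

open Set Metric Filter Topology
open scoped NNReal

variable {E : Type*} [NormedAddCommGroup E] [NormedSpace ℝ E]
  {W : Type*} [NormedAddCommGroup W] [NormedSpace ℝ W]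

/-- Picard–Lindelöf on `[0, 1]`, with the additional information that the solution stays in the
ball. -/
theorem exists_solution_mem_closedBall [CompleteSpace E] {v : E → E} {x₀ : E} {a K L : ℝ≥0}
    (hb : ∀ x ∈ closedBall x₀ a, ‖v x‖ ≤ L) (hl : LipschitzOnWith K v (closedBall x₀ a))
    (hLa : L ≤ a) :
    ∃ α : ℝ → E, α 0 = x₀ ∧ ∀ t ∈ Icc (0 : ℝ) 1, α t ∈ closedBall x₀ a ∧
      HasDerivWithinAt α (v (α t)) (Icc 0 1) t := by
  have hf : IsPicardLindelof (fun _ => v) (tmin := 0) (tmax := 1) ⟨0, by simp⟩ x₀ a 0 L K := by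
    apply IsPicardLindelof.of_time_independent hb hl
    simpa using hLa
  obtain ⟨α, hα⟩ := ODE.FunSpace.exists_isFixedPt_next hf (mem_closedBall_self le_rfl)
  refine ⟨α.compProj, ?_, fun t ht => ⟨α.compProj_mem_closedBall hf.mul_max_le, ?_⟩⟩
  · change α.compProj ((⟨0, by simp⟩ : Icc (0 : ℝ) 1) : ℝ) = x₀
    rw [ODE.FunSpace.compProj_val, ← hα, ODE.FunSpace.next_apply₀]
  · apply ODE.hasDerivWithinAt_picard_Icc (f := fun _ => v) (t₀ := 0) (by simp)
      hf.continuousOn_uncurry α.continuous_compProj.continuousOn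
      (fun _ ht' ↦ α.compProj_mem_closedBall hf.mul_max_le) x₀ ht |>.congr_of_mem _ ht
    intro t' ht'
    nth_rw 1 [← hα]
    rw [ODE.FunSpace.compProj_of_mem ht', ODE.FunSpace.next_apply]

theorem gronwallBound_zero_left (K ε x : ℝ) :
    gronwallBound 0 K ε x = ε * gronwallBound 0 K 1 x := by
  unfold gronwallBound
  split_ifs <;> ring

theorem hasDerivWithinAt_Ici_of_Icc {F : Type*} [NormedAddCommGroup F] [NormedSpace ℝ F]
    {f : ℝ → F} {f' : F} {t : ℝ} (ht : t ∈ Ico (0 : ℝ) 1)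
    (h : HasDerivWithinAt f f' (Icc 0 1) t) : HasDerivWithinAt f f' (Ici t) t :=
  h.mono_of_mem_nhdsWithin (mem_of_superset (Icc_mem_nhdsGE ht.2)
    (Icc_subset_Icc_left ht.1))

/-- A quadratic Taylor estimate for a map with Lipschitz derivative. -/
theorem norm_sub_sub_fderiv_le {F : Type*} [NormedAddCommGroup F] [NormedSpace ℝ F]
    {X : E → F} {s : Set E} (hs : Convex ℝ s) (hd : ∀ y ∈ s, DifferentiableAt ℝ X y) {m : ℝ≥0}
    (hl : LipschitzOnWith m (fderiv ℝ X) s) {y z : E} (hy : y ∈ s) (hz : z ∈ s) :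
    ‖X z - X y - fderiv ℝ X y (z - y)‖ ≤ m * ‖z - y‖ ^ 2 := by
  have hseg : segment ℝ y z ⊆ s := hs.segment_subset hy hz
  have := Convex.norm_image_sub_le_of_norm_hasFDerivWithin_le' (f := X) (s := segment ℝ y z)
    (f' := fderiv ℝ X) (φ := fderiv ℝ X y) (C := m * ‖z - y‖) (x := y) (y := z)
    (fun w hw => (hd w (hseg hw)).hasFDerivAt.hasFDerivWithinAt)
    (fun w hw => by
      refine (hl.norm_sub_le (hseg hw) hy).trans ?_
      gcongr
      obtain ⟨θ, ⟨h0, h1⟩, rfl⟩ := (segment_eq_image' ℝ y z) ▸ hw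
      rw [add_sub_cancel_left, norm_smul, Real.norm_of_nonneg h0]
      exact mul_le_of_le_one_left (norm_nonneg _) h1)
    (convex_segment y z) (left_mem_segment ℝ y z) (right_mem_segment ℝ y z)
  calc _ ≤ _ := this
    _ = _ := by ring

theorem ContinuousAt.eventually_norm_le {α : Type*} [TopologicalSpace α] {F : Type*}
    [NormedAddCommGroup F] {g : α → F} {x : α} (hg : ContinuousAt g x) : ∀ᶠ y in 𝓝 x, ‖g y‖ ≤ ‖g x‖ + 1 :=
  ((show ContinuousAt (fun y => ‖g y‖) x from hg.norm).eventually
    (gt_mem_nhds (lt_add_one _))).mono fun _ h => h.le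

theorem exists_ball_bounds {X : E → W →L[ℝ] E} {Ω : Set E} (hΩ : IsOpen Ω)
    (hX : ContDiffOn ℝ ∞ X Ω) {x₀ : E} (hx₀ : x₀ ∈ Ω) :
    ∃ (b m : ℝ≥0), 0 < b ∧ closedBall x₀ (2 * b) ⊆ Ω ∧
      LipschitzOnWith m X (closedBall x₀ (2 * b)) ∧
      LipschitzOnWith m (fderiv ℝ X) (closedBall x₀ (2 * b)) ∧
      (∀ y ∈ closedBall x₀ (2 * b), ‖X y‖ ≤ m) ∧
      (∀ y ∈ closedBall x₀ (2 * b), ‖fderiv ℝ X y‖ ≤ m) := by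
  have hXx : ContDiffAt ℝ ∞ X x₀ := hX.contDiffAt (hΩ.mem_nhds hx₀)
  have hDX : ContDiffAt ℝ 1 (fderiv ℝ X) x₀ := hXx.fderiv_right (by norm_cast)
  obtain ⟨K₁, s₁, hs₁, hl₁⟩ := 
    (hXx.of_le (m := 1) (by norm_cast)).exists_lipschitzOnWith
  obtain ⟨K₂, s₂, hs₂, hl₂⟩ := hDX.exists_lipschitzOnWith
  have h₃ := hXx.continuousAt.eventually_norm_le
  have h₄ := hDX.continuousAt.eventually_norm_le
  obtain ⟨ε, hε, hsub⟩ := Metric.nhds_basis_closedBall.mem_iff.1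
    (inter_mem (inter_mem hs₁ hs₂) (inter_mem (hΩ.mem_nhds hx₀) (inter_mem h₃ h₄)))
  lift ε to ℝ≥0 using hε.le
  have h2 : (2 : ℝ) * ((ε / 2 : ℝ≥0) : ℝ) = ε := by push_cast; ring
  refine ⟨ε / 2, max (max K₁ K₂) (max (‖X x₀‖₊ + 1) (‖fderiv ℝ X x₀‖₊ + 1)),
    half_pos (by exact_mod_cast hε), ?_⟩
  rw [h2]
  refine ⟨fun y hy => (hsub hy).2.1, ?_, ?_, fun y hy => ?_, fun y hy => ?_⟩
  · exact (hl₁.mono fun y hy => (hsub hy).1.1).weaken ((le_max_left _ _).trans (le_max_left _ _))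
  · exact (hl₂.mono fun y hy => (hsub hy).1.2).weaken ((le_max_right _ _).trans (le_max_left _ _))
  · refine (hsub hy).2.2.1.trans ?_
    exact_mod_cast (le_max_left (‖X x₀‖₊ + 1) (‖fderiv ℝ X x₀‖₊ + 1)).trans (le_max_right _ _)
  · refine (hsub hy).2.2.2.trans ?_
    exact_mod_cast (le_max_right (‖X x₀‖₊ + 1) (‖fderiv ℝ X x₀‖₊ + 1)).trans (le_max_right _ _)

/-- Solutions of the total differential equation `df = X ∘ f`. The compatibility condition is only
required on a set `N` that contains all the integral curves of the fields `X · u` starting at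
`x₀`. -/
theorem exists_total_differential_solution [CompleteSpace E] {X : E → W →L[ℝ] E} {Ω N : Set E}
    (hΩ : IsOpen Ω) (hX : ContDiffOn ℝ ∞ X Ω) {x₀ : E} (hx₀ : x₀ ∈ Ω)
    (hinv : ∀ (u : W) (γ : ℝ → E), γ 0 = x₀ →
      (∀ t ∈ Icc (0 : ℝ) 1, γ t ∈ Ω ∧ HasDerivWithinAt γ (X (γ t) u) (Icc 0 1) t) →
      ∀ t ∈ Icc (0 : ℝ) 1, γ t ∈ N)
    (hbr : ∀ y ∈ Ω, y ∈ N → ∀ u v, fderiv ℝ X y (X y u) v = fderiv ℝ X y (X y v) u) :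
    ∃ δ > 0, ∃ f : W → E, f 0 = x₀ ∧
      ∀ u ∈ ball (0 : W) δ, f u ∈ Ω ∧ f u ∈ N ∧ HasFDerivAt f (X (f u)) u := by
  obtain ⟨b, m, hb, hsub, hlX, hlD, hbX, hbD⟩ := exists_ball_bounds hΩ hX hx₀
  have hbb : closedBall x₀ b ⊆ closedBall x₀ (2 * b) :=
    closedBall_subset_closedBall (by linarith [b.2])
  obtain ⟨δ, hδ, hmδ⟩ : ∃ δ : ℝ≥0, 0 < δ ∧ m * δ ≤ b := by
    refine ⟨b / (m + 1), by positivity, ?_⟩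
    rw [mul_div_assoc', div_le_iff₀ (by positivity), mul_comm]
    gcongr
    exact le_self_add
  have hlip : ∀ u : W, LipschitzOnWith (m * ‖u‖₊) (fun y => X y u) (closedBall x₀ (2 * b)) := by
    intro u
    refine LipschitzOnWith.of_dist_le_mul fun y hy z hz => ?_
    rw [dist_eq_norm, ← sub_apply]
    refine (ContinuousLinearMap.le_opNorm _ _).trans ?_
    have := hlX.dist_le_mul y hy z hz
    rw [dist_eq_norm] at this
    calc _ ≤ (m * dist y z) * ‖u‖ := by gcongr
      _ = _ := by push_cast; ring
  have hex : ∀ u : W, ∃ γ : ℝ → E, ‖u‖ < δ → γ 0 = x₀ ∧ ∀ t ∈ Icc (0 : ℝ) 1,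
      γ t ∈ closedBall x₀ b ∧ HasDerivWithinAt γ (X (γ t) u) (Icc 0 1) t := by
    intro u
    by_cases hu : ‖u‖ < δ
    · obtain ⟨γ, h⟩ := exists_solution_mem_closedBall (v := fun y => X y u) (x₀ := x₀) (a := b)
        (L := m * δ) (fun y hy => by
          refine (ContinuousLinearMap.le_opNorm _ _).trans ?_
          push_cast
          gcongr
          exact hbX y (hbb hy)) ((hlip u).mono hbb) hmδ
      exact ⟨γ, fun _ => h⟩
    · exact ⟨0, fun h => absurd h hu⟩
  choose γ hγ using hex
  have hN : ∀ u : W, ‖u‖ < δ → ∀ t ∈ Icc (0 : ℝ) 1, γ u t ∈ N := fun u hu =>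
    hinv u (γ u) (hγ u hu).1 fun t ht =>
      ⟨hsub (hbb ((hγ u hu).2 t ht).1), ((hγ u hu).2 t ht).2⟩
  have h1 : (1 : ℝ) ∈ Icc (0 : ℝ) 1 := by simp
  refine ⟨δ, hδ, fun u => γ u 1, ?_, fun u hu => ?_⟩
  · have h0 : ‖(0 : W)‖ < δ := by simpa using hδ
    have := constant_of_has_deriv_right_zero (f := γ 0) (a := 0) (b := 1)
      (fun t ht => ((hγ 0 h0).2 t ht).2.continuousWithinAt)
      (fun t ht => by
        simpa using hasDerivWithinAt_Ici_of_Icc ht ((hγ 0 h0).2 t ⟨ht.1, ht.2.le⟩).2) 1 h1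
    exact this.trans (hγ 0 h0).1
  have hu : ‖u‖ < δ := by simpa using hu
  obtain ⟨hγ0, hγu⟩ := hγ u hu
  refine ⟨hsub (hbb (hγu 1 h1).1), hN u hu 1 h1, ?_⟩
  have hdX : ∀ y ∈ closedBall x₀ (2 * b), DifferentiableAt ℝ X y := fun y hy =>
    (hX.contDiffAt (hΩ.mem_nhds (hsub hy))).differentiableAt (by simp)
  obtain ⟨C, hC⟩ : ∃ C : ℝ, ∀ h : W, ‖u + h‖ < δ → m * ‖h‖ ≤ b →
      ‖γ (u + h) 1 - γ u 1 - X (γ u 1) h‖ ≤ C * ‖h‖ ^ 2 := by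
    refine ⟨(m * m + m * m ^ 2 * δ) * gronwallBound 0 (m * δ) 1 1, fun h huh hmh => ?_⟩
    set g : ℝ → E := fun t => γ u t + t • X (γ u t) h with hg
    set g' : ℝ → E := fun t => X (γ u t) u +
      (X (γ u t) h + t • fderiv ℝ X (γ u t) (X (γ u t) u) h) with hg'
    have hgd : ∀ t ∈ Icc (0 : ℝ) 1, HasDerivWithinAt g (g' t) (Icc 0 1) t := by
      intro t ht
      have hγt := (hγu t ht).2
      have hXt : HasDerivWithinAt (fun t => X (γ u t))
          (fderiv ℝ X (γ u t) (X (γ u t) u)) (Icc 0 1) t :=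
        (hdX _ (hbb (hγu t ht).1)).hasFDerivAt.comp_hasDerivWithinAt t hγt
      have hXh : HasDerivWithinAt (fun t => X (γ u t) h)
          (fderiv ℝ X (γ u t) (X (γ u t) u) h) (Icc 0 1) t :=
        by simpa using hXt.clm_apply (hasDerivWithinAt_const t _ h)
      have := hγt.add ((hasDerivWithinAt_id t (Icc (0 : ℝ) 1)).smul hXh)
      simp only [id_eq, one_smul] at this
      convert! this using 1
      simp only [hg']
      abel
    have hgmem : ∀ t ∈ Icc (0 : ℝ) 1, ‖g t - γ u t‖ ≤ m * ‖h‖ ∧ g t ∈ closedBall x₀ (2 * b) := by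
      intro t ht
      have h1 : ‖g t - γ u t‖ ≤ m * ‖h‖ := by
        simp only [hg, add_sub_cancel_left, norm_smul, Real.norm_of_nonneg ht.1]
        refine (mul_le_of_le_one_left (norm_nonneg _) ht.2).trans ?_
        refine (ContinuousLinearMap.le_opNorm _ _).trans ?_
        gcongr
        exact hbX _ (hbb (hγu t ht).1)
      refine ⟨h1, ?_⟩
      rw [mem_closedBall]
      have h2 := mem_closedBall.1 (hγu t ht).1
      calc dist (g t) x₀ ≤ dist (g t) (γ u t) + dist (γ u t) x₀ := dist_triangle _ _ _
        _ ≤ b + b := by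
          gcongr
          rw [dist_eq_norm]
          exact h1.trans hmh
        _ = 2 * b := by ring
    have key := dist_le_of_approx_trajectories_ODE_of_mem (v := fun _ y => X y (u + h))
      (s := fun _ => closedBall x₀ (2 * b)) (K := m * δ) (a := 0) (b := 1) (δ := 0)
      (f := g) (g := γ (u + h)) (f' := g') (g' := fun t => X (γ (u + h) t) (u + h))
      (εf := (m * m + m * m ^ 2 * δ) * ‖h‖ ^ 2) (εg := 0)
      (fun t _ => (hlip (u + h)).weaken (by gcongr; exact_mod_cast huh.le))
      (fun t ht => (hgd t ht).continuousWithinAt)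
      (fun t ht => hasDerivWithinAt_Ici_of_Icc ht (hgd t ⟨ht.1, ht.2.le⟩))
      (fun t ht => by
        have ht' : t ∈ Icc (0 : ℝ) 1 := ⟨ht.1, ht.2.le⟩
        have hmem := hbb (hγu t ht').1
        have hT := norm_sub_sub_fderiv_le (convex_closedBall x₀ (2 * b)) hdX hlD hmem
          (hgmem t ht').2
        have hT' : ‖X (g t) - X (γ u t) - fderiv ℝ X (γ u t) (g t - γ u t)‖
            ≤ m * (m * ‖h‖) ^ 2 := by
          refine hT.trans ?_
          gcongr
          exact (hgmem t ht').1
        have hsym := hbr (γ u t) (hsub hmem) (hN u hu t ht') u h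
        have heq : g' t - X (g t) (u + h) =
            -(t • fderiv ℝ X (γ u t) (X (γ u t) h) h) -
            (X (g t) - X (γ u t) - fderiv ℝ X (γ u t) (g t - γ u t)) (u + h) := by
          simp only [hg', hg, hsym, add_sub_cancel_left, sub_apply, map_add,
            map_smul, smul_apply]
          abel
        rw [dist_eq_norm, heq]
        refine (norm_sub_le _ _).trans ?_
        rw [norm_neg, norm_smul, Real.norm_of_nonneg ht.1]
        have e1 : t * ‖fderiv ℝ X (γ u t) (X (γ u t) h) h‖ ≤ m * m * ‖h‖ ^ 2 := by
          refine (mul_le_of_le_one_left (norm_nonneg _) ht'.2).trans ?_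
          calc _ ≤ ‖fderiv ℝ X (γ u t) (X (γ u t) h)‖ * ‖h‖ := ContinuousLinearMap.le_opNorm _ _
            _ ≤ (‖fderiv ℝ X (γ u t)‖ * (‖X (γ u t)‖ * ‖h‖)) * ‖h‖ := by
              gcongr
              exact (ContinuousLinearMap.le_opNorm _ _).trans
                (by gcongr; exact ContinuousLinearMap.le_opNorm _ _)
            _ ≤ (m * (m * ‖h‖)) * ‖h‖ := by
              gcongr
              · exact hbD _ hmem
              · exact hbX _ hmem
            _ = _ := by ring
        have e2 : ‖(X (g t) - X (γ u t) - fderiv ℝ X (γ u t) (g t - γ u t)) (u + h)‖ ≤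
            m * m ^ 2 * δ * ‖h‖ ^ 2 := by
          refine (ContinuousLinearMap.le_opNorm _ _).trans ?_
          calc _ ≤ (m * (m * ‖h‖) ^ 2) * δ := by gcongr
            _ = _ := by ring
        calc _ ≤ m * m * ‖h‖ ^ 2 + m * m ^ 2 * δ * ‖h‖ ^ 2 := add_le_add e1 e2
          _ = _ := by ring)
      (fun t ht => (hgmem t ⟨ht.1, ht.2.le⟩).2)
      (fun t ht => ((hγ (u + h) huh).2 t ht).2.continuousWithinAt)
      (fun t ht => hasDerivWithinAt_Ici_of_Icc ht ((hγ (u + h) huh).2 t ⟨ht.1, ht.2.le⟩).2)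
      (fun t ht => by simp)
      (fun t ht => hbb ((hγ (u + h) huh).2 t ⟨ht.1, ht.2.le⟩).1)
      (by simp [hg, hγ0, (hγ (u + h) huh).1]) 1 h1
    rw [gronwallBound_zero_left, dist_comm, dist_eq_norm] at key
    simp only [hg, one_smul, sub_zero, add_zero] at key
    rw [sub_sub]
    refine key.trans (le_of_eq ?_)
    push_cast
    ring
  rw [hasFDerivAt_iff_isLittleO_nhds_zero]
  have hO : (fun h : W => γ (u + h) 1 - γ u 1 - X (γ u 1) h) =O[𝓝 0] fun h => ‖h‖ ^ 2 := by
    refine Asymptotics.IsBigO.of_bound C ?_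
    have c1 : ∀ᶠ h : W in 𝓝 0, ‖u + h‖ < δ := by
      have : Tendsto (fun h : W => ‖u + h‖) (𝓝 0) (𝓝 ‖u + 0‖) := by
        exact (by fun_prop : Continuous fun h : W => ‖u + h‖).tendsto 0
      exact this.eventually (gt_mem_nhds (by simpa using hu))
    have c2 : ∀ᶠ h : W in 𝓝 0, m * ‖h‖ < b := by
      have : Tendsto (fun h : W => m * ‖h‖) (𝓝 0) (𝓝 (m * ‖(0 : W)‖)) := by
        exact (by fun_prop : Continuous fun h : W => (m : ℝ) * ‖h‖).tendsto 0
      exact this.eventually (gt_mem_nhds (by simpa using hb))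
    filter_upwards [c1, c2] with h h1 h2
    simpa using hC h h1 h2.le
  refine hO.trans_isLittleO ?_
  exact Asymptotics.isLittleO_norm_pow_id one_lt_two

end Frobenius

section Involutive

open Set Metric Filter Topology

variable {E : Type*} [NormedAddCommGroup E] [NormedSpace ℝ E]
  {A : Type*} [NormedAddCommGroup A] [NormedSpace ℝ A]

/-- A linear map of finite rank factors through a Euclidean space. -/
theorem exists_section_projection [FiniteDimensional ℝ E] [FiniteDimensional ℝ A]
    (T : A →L[ℝ] E) :
    ∃ (d : ℕ) (s : EuclideanSpace ℝ (Fin d) →L[ℝ] A) (p : E →L[ℝ] EuclideanSpace ℝ (Fin d)),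
      (∀ w, p (T (s w)) = w) ∧ ∀ c, T (s (p (T c))) = T c := by
  let R : Submodule ℝ E := LinearMap.range (T : A →ₗ[ℝ] E)
  let φ : EuclideanSpace ℝ (Fin (Module.finrank ℝ R)) ≃L[ℝ] R :=
    ContinuousLinearEquiv.ofFinrankEq (by simp)
  obtain ⟨s, hs⟩ := (T : A →ₗ[ℝ] E).rangeRestrict.exists_rightInverse_of_surjective
    (LinearMap.range_rangeRestrict _)
  obtain ⟨q, hq⟩ := R.subtype.exists_leftInverse_of_injective R.ker_subtype
  have hs' : ∀ w : R, T (s w) = w := fun w =>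
    congrArg Subtype.val (LinearMap.congr_fun hs w)
  have hq' : ∀ w : R, q w = w := fun w => LinearMap.congr_fun hq w
  refine ⟨Module.finrank ℝ R, (LinearMap.toContinuousLinearMap s) ∘L (φ : _ →L[ℝ] R),
    (φ.symm : R →L[ℝ] _) ∘L (LinearMap.toContinuousLinearMap q), fun w => ?_, fun c => ?_⟩
  · simp [hs', hq']
  · have := hq' ⟨T c, c, rfl⟩
    simp only at this
    simp [this, hs']

theorem contDiffOn_infty_of_hasFDerivAt_comp {W : Type*} [NormedAddCommGroup W] [NormedSpace ℝ W]
    {X : E → W →L[ℝ] E} {Ω : Set E} (hX : ContDiffOn ℝ ∞ X Ω) {f : W → E} {U : Set W}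
    (hU : IsOpen U) (hfU : ∀ u ∈ U, f u ∈ Ω) (hf : ∀ u ∈ U, HasFDerivAt f (X (f u)) u) :
    ContDiffOn ℝ ∞ f U := by
  rw [contDiffOn_infty]
  intro n
  induction n with
  | zero =>
    exact contDiffOn_zero.2 fun u hu => (hf u hu).continuousAt.continuousWithinAt
  | succ n ih =>
    push_cast
    rw [contDiffOn_succ_iff_fderiv_of_isOpen hU]
    refine ⟨fun u hu => (hf u hu).differentiableAt.differentiableWithinAt, by simp, ?_⟩
    have : ContDiffOn ℝ n (fun u => X (f u)) U :=
      (hX.of_le (by exact_mod_cast le_top)).comp ih hfU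
    exact this.congr fun u hu => (hf u hu).fderiv

/-- `M` is, near each of its points, a smooth retract of an open subset of `E`. -/
def IsLocalSmoothRetract (M : Set E) : Prop :=
  ∀ x ∈ M, ∃ (Ω : Set E) (r : E → E), IsOpen Ω ∧ x ∈ Ω ∧ ContDiffOn ℝ ∞ r Ω ∧
    MapsTo r Ω M ∧ ∀ y ∈ M, y ∈ Ω → r y = y

theorem fderiv_retract_apply {M Ω : Set E} {r : E → E} (hΩ : IsOpen Ω)
    (hr : ContDiffOn ℝ ∞ r Ω) (hid : ∀ y ∈ M, y ∈ Ω → r y = y) {y v : E} (hy : y ∈ M)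
    (hyΩ : y ∈ Ω) (hv : v ∈ tangentConeAt ℝ M y) : fderiv ℝ r y v = v := by
  have h1 : HasFDerivWithinAt r (fderiv ℝ r y) M y :=
    ((hr.contDiffAt (hΩ.mem_nhds hyΩ)).differentiableAt (by simp)).hasFDerivAt.hasFDerivWithinAt
  have h2 : HasFDerivWithinAt r (ContinuousLinearMap.id ℝ E) M y := by
    refine (hasFDerivWithinAt_id y M).congr_of_eventuallyEq ?_ (hid y hy hyΩ)
    filter_upwards [self_mem_nhdsWithin, mem_nhdsWithin_of_mem_nhds (hΩ.mem_nhds hyΩ)] with z hz hz'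
    exact hid z hz hz'
  exact h1.unique_on h2 hv

theorem fderiv_comp_retract_apply {F : Type*} [NormedAddCommGroup F] [NormedSpace ℝ F]
    {M Ω : Set E} {r : E → E} (hΩ : IsOpen Ω)
    (hr : ContDiffOn ℝ ∞ r Ω) (hmaps : MapsTo r Ω M) (hid : ∀ y ∈ M, y ∈ Ω → r y = y) {y v : E}
    (hy : y ∈ M) (hyΩ : y ∈ Ω) (hv : v ∈ tangentConeAt ℝ M y) {g : E → F} {g' : E →L[ℝ] F}
    (hg : HasFDerivWithinAt g g' M y) : fderiv ℝ (g ∘ r) y v = g' v := by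
  have h1 : HasFDerivAt r (fderiv ℝ r y) y :=
    ((hr.contDiffAt (hΩ.mem_nhds hyΩ)).differentiableAt (by simp)).hasFDerivAt
  have hg' : HasFDerivWithinAt g g' M (r y) := by rwa [hid y hy hyΩ]
  have h2 : HasFDerivWithinAt (g ∘ r) (g' ∘L fderiv ℝ r y) Ω y :=
    hg'.comp y h1.hasFDerivWithinAt hmaps
  rw [(h2.hasFDerivAt (hΩ.mem_nhds hyΩ)).fderiv]
  simp [fderiv_retract_apply hΩ hr hid hy hyΩ hv]

theorem ContDiffOn.hasFDerivAt_of_isOpen {F : Type*} [NormedAddCommGroup F] [NormedSpace ℝ F]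
    {g : E → F} {Ω : Set E} (hg : ContDiffOn ℝ ∞ g Ω) (hΩ : IsOpen Ω) {y : E} (hy : y ∈ Ω) :
    HasFDerivAt g (fderiv ℝ g y) y :=
  ((hg.contDiffAt (hΩ.mem_nhds hy)).differentiableAt (by simp)).hasFDerivAt

theorem ContDiffOn.continuousAt_of_isOpen {F : Type*} [NormedAddCommGroup F] [NormedSpace ℝ F]
    {g : E → F} {Ω : Set E} (hg : ContDiffOn ℝ ∞ g Ω) (hΩ : IsOpen Ω) {y : E} (hy : y ∈ Ω) :
    ContinuousAt g y :=
  (hg.contDiffAt (hΩ.mem_nhds hy)).continuousAt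

theorem comp_fderiv_eq_zero {B W : Type*} [NormedAddCommGroup B] [NormedSpace ℝ B]
    [NormedAddCommGroup W] [NormedSpace ℝ W] {g : E → B →L[ℝ] E} {p : E →L[ℝ] W}
    {q : B →L[ℝ] W} {Ω : Set E} (hΩ : IsOpen Ω) (hg : ContDiffOn ℝ ∞ g Ω)
    (hq : ∀ y ∈ Ω, p ∘L g y = q) {y : E} (hy : y ∈ Ω) (v : E) (c : B) :
    p (fderiv ℝ g y v c) = 0 := by
  have h1 : HasFDerivAt (fun y => p ∘L g y)
      ((ContinuousLinearMap.compL ℝ B E W p) ∘L fderiv ℝ g y) y :=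
    (ContinuousLinearMap.compL ℝ B E W p).hasFDerivAt.comp y (hg.hasFDerivAt_of_isOpen hΩ hy)
  have h2 : HasFDerivAt (fun y => p ∘L g y) (0 : E →L[ℝ] B →L[ℝ] W) y :=
    (hasFDerivAt_const q y).congr_of_eventuallyEq
      (by filter_upwards [hΩ.mem_nhds hy] with z hz using hq z hz)
  simpa using DFunLike.congr_fun (DFunLike.congr_fun (h1.unique h2) v) c

set_option maxHeartbeats 1000000 in
theorem exists_integralPatch_of_involutive [FiniteDimensional ℝ E] [FiniteDimensional ℝ A]
    {M : Set E} {D : E → Submodule ℝ E} {ρ : E → A →L[ℝ] E}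
    (hret : IsLocalSmoothRetract M) (hρ : ContDiffOn ℝ ∞ ρ M)
    (hD : ∀ y ∈ M, (ρ y).range = D y)
    (htan : ∀ y ∈ M, ∀ c, ρ y c ∈ tangentConeAt ℝ M y) {x₀ : E} (hx₀ : x₀ ∈ M) {m : ℝ}
    (hinv : ∀ᶠ y in 𝓝[M] x₀, ∃ ρ' : E →L[ℝ] A →L[ℝ] E, HasFDerivWithinAt ρ ρ' M y ∧
      ∀ c d, ∃ e, ‖e‖ ≤ m * ‖c‖ * ‖d‖ ∧ ρ' (ρ y c) d - ρ' (ρ y d) c = ρ y e) :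
    ∃ (d : ℕ) (U : Set (EuclideanSpace ℝ (Fin d))) (f : EuclideanSpace ℝ (Fin d) → E),
      IsIntegralPatch M D U f ∧ x₀ ∈ f '' U := by
  have : CompleteSpace E := FiniteDimensional.complete ℝ E
  obtain ⟨Ω, r, hΩ, hxΩ, hr, hmaps, hid⟩ := hret x₀ hx₀
  obtain ⟨d, s, p, hps, hsp⟩ := exists_section_projection (ρ x₀)
  set R : E → A →L[ℝ] E := ρ ∘ r with hR
  have hRρ : ∀ y ∈ M, y ∈ Ω → R y = ρ y := fun y hy hy' => by simp [hR, hid y hy hy']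
  have hRs : ContDiffOn ℝ ∞ R Ω := hρ.comp hr hmaps
  set P : E → EuclideanSpace ℝ (Fin d) →L[ℝ] EuclideanSpace ℝ (Fin d) :=
    fun y => p ∘L (R y ∘L s) with hP
  have hPs : ContDiffOn ℝ ∞ P Ω := contDiffOn_const.clm_comp (hRs.clm_comp contDiffOn_const)
  have hP0 : P x₀ = 1 := by
    ext1 w
    simp [hP, hRρ x₀ hx₀ hxΩ, hps]
  set Ω₁ : Set E := Ω ∩ P ⁻¹' {q | IsUnit q} with hΩ₁
  have hΩ₁o : IsOpen Ω₁ := hPs.continuousOn.isOpen_inter_preimage hΩ Units.isOpen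
  have hxΩ₁ : x₀ ∈ Ω₁ := ⟨hxΩ, by simp [hP0]⟩
  set a : E → EuclideanSpace ℝ (Fin d) →L[ℝ] A := fun y => s ∘L Ring.inverse (P y) with ha
  have has : ContDiffOn ℝ ∞ a Ω₁ := by
    refine contDiffOn_const.clm_comp fun y hy => ?_
    obtain ⟨q, hq⟩ := hy.2
    have := contDiffAt_ringInverse ℝ (n := ∞) q
    rw [hq] at this
    exact this.comp_contDiffWithinAt y ((hPs y hy.1).mono inter_subset_left)
  have hRs₁ : ContDiffOn ℝ ∞ R Ω₁ := hRs.mono inter_subset_left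
  set X : E → EuclideanSpace ℝ (Fin d) →L[ℝ] E := fun y => R y ∘L a y with hXdef
  have hXs : ContDiffOn ℝ ∞ X Ω₁ := hRs₁.clm_comp has
  set b : E → A →L[ℝ] A := fun y => ContinuousLinearMap.id ℝ A - a y ∘L (p ∘L R y) with hb
  have hbs : ContDiffOn ℝ ∞ b Ω₁ :=
    contDiffOn_const.sub (has.clm_comp (contDiffOn_const.clm_comp hRs₁))
  set Z : E → A →L[ℝ] E := fun y => R y ∘L b y with hZdef
  have hZs : ContDiffOn ℝ ∞ Z Ω₁ := hRs₁.clm_comp hbs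
  have hpX : ∀ y ∈ Ω₁, p ∘L X y = ContinuousLinearMap.id ℝ _ := fun y hy => by
    have h : P y * Ring.inverse (P y) = 1 := Ring.mul_inverse_cancel _ hy.2
    ext1 w
    exact DFunLike.congr_fun h w
  have hpX' : ∀ y ∈ Ω₁, ∀ w, p (X y w) = w := fun y hy w => DFunLike.congr_fun (hpX y hy) w
  have hZX : ∀ y, ∀ c, Z y c = R y c - X y (p (R y c)) := fun y c => by simp [hZdef, hXdef, hb]
  have hpZ : ∀ y ∈ Ω₁, p ∘L Z y = 0 := fun y hy => by
    ext1 c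
    simp [hZX, hpX' y hy]
  have hZ0 : Z x₀ = 0 := by
    ext1 c
    simp [hZdef, hb, ha, hP0, hRρ x₀ hx₀ hxΩ, hsp]
  have hDX : ∀ y ∈ Ω₁, ∀ v w, fderiv ℝ X y v w = fderiv ℝ R y v (a y w) +
      R y (fderiv ℝ a y v w) := fun y hy v w => by
    rw [((hRs₁.hasFDerivAt_of_isOpen hΩ₁o hy).clm_comp (has.hasFDerivAt_of_isOpen hΩ₁o hy)).fderiv]
    exact add_comm _ _
  have hDZ : ∀ y ∈ Ω₁, ∀ v c, fderiv ℝ Z y v c = fderiv ℝ R y v (b y c) +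
      R y (fderiv ℝ b y v c) := fun y hy v c => by
    rw [((hRs₁.hasFDerivAt_of_isOpen hΩ₁o hy).clm_comp (hbs.hasFDerivAt_of_isOpen hΩ₁o hy)).fderiv]
    exact add_comm _ _
  have hZker : ∀ y e, p (R y e) = 0 → R y e = Z y e := fun y e he => by simp [hZX, he]
  set h : E → EuclideanSpace ℝ (Fin d) →L[ℝ] E := fun y => X y - fderiv ℝ r y ∘L X y with hh
  have hDr : ContDiffOn ℝ ∞ (fderiv ℝ r) Ω₁ :=
    (hr.fderiv_of_isOpen hΩ (by simp)).mono inter_subset_left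
  have hhs : ContDiffOn ℝ ∞ h Ω₁ := hXs.sub (hDr.clm_comp hXs)
  have hh0 : ∀ y ∈ M, y ∈ Ω₁ → h y = 0 := fun y hy hy' => by
    ext1 w
    have := fderiv_retract_apply hΩ hr hid hy hy'.1 (htan y hy (a y w))
    simp [hh, hXdef, hRρ y hy hy'.1, this]
  obtain ⟨κ, σ, hσ, hlip⟩ := ((hhs.contDiffAt (hΩ₁o.mem_nhds hxΩ₁)).of_le
    (m := 1) (by norm_cast)).exists_lipschitzOnWith
  have hrx : r x₀ = x₀ := hid x₀ hx₀ hxΩ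
  have hrc : Tendsto r (𝓝 x₀) (𝓝 x₀) := by
    have := (hr.contDiffAt (hΩ.mem_nhds hxΩ)).continuousAt
    rwa [ContinuousAt, hrx] at this
  have hbound := ((has.continuousAt_of_isOpen hΩ₁o hxΩ₁).prodMk
    ((hbs.continuousAt_of_isOpen hΩ₁o hxΩ₁).prodMk
    ((hXs.continuousAt_of_isOpen hΩ₁o hxΩ₁).prodMk
    ((hZs.continuousAt_of_isOpen hΩ₁o hxΩ₁).prodMk
    (((has.fderiv_of_isOpen hΩ₁o (by simp)).continuousAt_of_isOpen hΩ₁o hxΩ₁).prodMk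
    (((hbs.fderiv_of_isOpen hΩ₁o (by simp)).continuousAt_of_isOpen hΩ₁o hxΩ₁).prodMk
    ((hXs.fderiv_of_isOpen hΩ₁o (by simp)).continuousAt_of_isOpen hΩ₁o hxΩ₁))))))
    ).eventually_norm_le
  obtain ⟨B, hB0, hbound⟩ : ∃ B : ℝ, 0 ≤ B ∧ ∀ᶠ y in 𝓝 x₀,
      ‖(a y, b y, X y, Z y, fderiv ℝ a y, fderiv ℝ b y, fderiv ℝ X y)‖ ≤ B :=
    ⟨_, by positivity, hbound⟩
  simp only [Prod.norm_def, sup_le_iff] at hbound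
  rw [eventually_nhdsWithin_iff] at hinv
  obtain ⟨ε, hε, hball⟩ := Metric.eventually_nhds_iff_ball.1
    (hbound.and (hinv.and ((show ∀ᶠ y in 𝓝 x₀, y ∈ Ω₁ from hΩ₁o.mem_nhds hxΩ₁).and
      ((hrc.eventually (hΩ₁o.mem_nhds hxΩ₁)).and
        ((show ∀ᶠ y in 𝓝 x₀, y ∈ σ from hσ).and (hrc.eventually hσ))))))
  have hbΩ : ball x₀ ε ⊆ Ω₁ := fun y hy => (hball y hy).2.2.1
  have hZbound : ∀ y ∈ ball x₀ ε, y ∈ M → ∀ u, ‖fderiv ℝ Z y (X y u)‖ ≤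
      ((B + (|m| * B * B + B * B + B * B)) * ‖u‖) * ‖Z y‖ := by
    intro y hy hyM u
    obtain ⟨⟨ba, bb, bX, bZ, bDa, bDb, bDX⟩, hinvy, hyΩ, -⟩ := hball y hy
    obtain ⟨ρ', hρ', hbr⟩ := hinvy hyM
    have hρ'R : ∀ c, fderiv ℝ R y (R y c) = ρ' (ρ y c) := fun c => by
      rw [hRρ y hyM hyΩ.1]
      exact fderiv_comp_retract_apply hΩ hr hmaps hid hyM hyΩ.1 (htan y hyM c) hρ'
    refine ContinuousLinearMap.opNorm_le_bound _ (by positivity) fun c => ?_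
    obtain ⟨e, he, hebr⟩ := hbr (a y u) (b y c)
    have heq : fderiv ℝ Z y (X y u) c - fderiv ℝ X y (Z y c) u =
        R y (e + fderiv ℝ b y (X y u) c - fderiv ℝ a y (Z y c) u) := by
      rw [hDZ y hyΩ, hDX y hyΩ]
      simp only [hXdef, hZdef, ContinuousLinearMap.comp_apply, hρ'R, map_add, map_sub]
      rw [hRρ y hyM hyΩ.1, ← hebr]
      abel
    have hp : p (R y (e + fderiv ℝ b y (X y u) c - fderiv ℝ a y (Z y c) u)) = 0 := by
      rw [← heq, map_sub, comp_fderiv_eq_zero hΩ₁o hZs hpZ hyΩ, comp_fderiv_eq_zero hΩ₁o hXs hpX hyΩ,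
        sub_zero]
    rw [hZker y _ hp, sub_eq_iff_eq_add] at heq
    rw [heq]
    have h1 : ‖fderiv ℝ X y (Z y c) u‖ ≤ B * (‖Z y‖ * ‖c‖) * ‖u‖ :=
      ((fderiv ℝ X y (Z y c)).le_of_opNorm_le
        ((fderiv ℝ X y).le_of_opNorm_le_of_le bDX ((Z y).le_opNorm c)) u)
    have h2 : ‖e‖ ≤ |m| * (B * ‖u‖) * (B * ‖c‖) := by
      refine he.trans ?_
      gcongr
      · exact le_abs_self m
      · exact (a y).le_of_opNorm_le ba u
      · exact (b y).le_of_opNorm_le bb c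
    have h3 : ‖fderiv ℝ b y (X y u) c‖ ≤ B * (B * ‖u‖) * ‖c‖ :=
      (fderiv ℝ b y (X y u)).le_of_opNorm_le
        ((fderiv ℝ b y).le_of_opNorm_le_of_le bDb ((X y).le_of_opNorm_le bX u)) c
    have h4 : ‖fderiv ℝ a y (Z y c) u‖ ≤ B * (B * ‖c‖) * ‖u‖ :=
      (fderiv ℝ a y (Z y c)).le_of_opNorm_le
        ((fderiv ℝ a y).le_of_opNorm_le_of_le bDa ((Z y).le_of_opNorm_le bZ c)) u
    calc _ ≤ ‖Z y‖ * ‖e + fderiv ℝ b y (X y u) c - fderiv ℝ a y (Z y c) u‖ +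
          ‖fderiv ℝ X y (Z y c) u‖ :=
          (norm_add_le _ _).trans (by gcongr; exact (Z y).le_opNorm _)
      _ ≤ ‖Z y‖ * (|m| * (B * ‖u‖) * (B * ‖c‖) + B * (B * ‖u‖) * ‖c‖ + B * (B * ‖c‖) * ‖u‖) +
          B * (‖Z y‖ * ‖c‖) * ‖u‖ := by
          gcongr
          refine (norm_sub_le _ _).trans (add_le_add ((norm_add_le _ _).trans ?_) h4)
          exact add_le_add h2 h3
      _ = _ := by ring
  obtain ⟨δ, hδ, f, hf0, hf⟩ := exists_total_differential_solution (Ω := ball x₀ ε)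
    (N := {y | y ∈ M ∧ Z y = 0}) isOpen_ball (hXs.mono hbΩ) (mem_ball_self hε)
    (fun u γ hγ0 hγ => by
      have hM : ∀ t ∈ Icc (0 : ℝ) 1, γ t ∈ M := by
        have hder : ∀ t ∈ Icc (0 : ℝ) 1, HasDerivWithinAt (fun t => γ t - r (γ t)) (h (γ t) u)
            (Icc 0 1) t := fun t ht => by
          obtain ⟨hmem, hd⟩ := hγ t ht
          have := hd.sub ((hr.hasFDerivAt_of_isOpen hΩ
            (hbΩ hmem).1).comp_hasDerivWithinAt t hd)
          simpa [hh] using! this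
        have hz := eq_zero_of_abs_deriv_le_mul_abs_self_of_eq_zero_right (K := κ * ‖u‖)
          (fun t ht => (hder t ht).continuousWithinAt)
          (fun t ht => hasDerivWithinAt_Ici_of_Icc ht (hder t ⟨ht.1, ht.2.le⟩))
          (by simp [hγ0, hrx])
          (fun t ht => by
            obtain ⟨-, -, h1, h2, h3, h4⟩ := hball _ (hγ t ⟨ht.1, ht.2.le⟩).1
            have h5 := hlip.norm_sub_le h3 h4
            rw [hh0 _ (hmaps h1.1) h2, sub_zero] at h5
            calc _ ≤ _ := (h (γ t)).le_of_opNorm_le h5 u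
              _ = _ := by ring)
        intro t ht
        have := hmaps (hbΩ (hγ t ht).1).1
        rwa [← sub_eq_zero.1 (hz t ht)] at this
      have hder : ∀ t ∈ Icc (0 : ℝ) 1, HasDerivWithinAt (fun t => Z (γ t))
          (fderiv ℝ Z (γ t) (X (γ t) u)) (Icc 0 1) t := fun t ht =>
        (hZs.hasFDerivAt_of_isOpen hΩ₁o (hbΩ (hγ t ht).1)).comp_hasDerivWithinAt t (hγ t ht).2
      have hz := eq_zero_of_abs_deriv_le_mul_abs_self_of_eq_zero_right
        (fun t ht => (hder t ht).continuousWithinAt)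
        (fun t ht => hasDerivWithinAt_Ici_of_Icc ht (hder t ⟨ht.1, ht.2.le⟩))
        (by simp [hγ0, hZ0])
        (fun t ht => hZbound _ (hγ t ⟨ht.1, ht.2.le⟩).1 (hM t ⟨ht.1, ht.2.le⟩) u)
      exact fun t ht => ⟨hM t ht, hz t ht⟩)
    (fun y hy hyN u v => by
      obtain ⟨hyM, hZy⟩ := hyN
      obtain ⟨-, hinvy, hyΩ, -⟩ := hball y hy
      obtain ⟨ρ', hρ', hbr⟩ := hinvy hyM
      have hρ'R : ∀ c, fderiv ℝ R y (R y c) = ρ' (ρ y c) := fun c => by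
        rw [hRρ y hyM hyΩ.1]
        exact fderiv_comp_retract_apply hΩ hr hmaps hid hyM hyΩ.1 (htan y hyM c) hρ'
      obtain ⟨e, -, hebr⟩ := hbr (a y u) (a y v)
      have heq : fderiv ℝ X y (X y u) v - fderiv ℝ X y (X y v) u =
          R y (e + fderiv ℝ a y (X y u) v - fderiv ℝ a y (X y v) u) := by
        rw [hDX y hyΩ, hDX y hyΩ]
        simp only [hXdef, ContinuousLinearMap.comp_apply, hρ'R, map_add, map_sub]
        rw [hRρ y hyM hyΩ.1, ← hebr]
        abel
      have hp : p (R y (e + fderiv ℝ a y (X y u) v - fderiv ℝ a y (X y v) u)) = 0 := by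
        rw [← heq, map_sub, comp_fderiv_eq_zero hΩ₁o hXs hpX hyΩ,
          comp_fderiv_eq_zero hΩ₁o hXs hpX hyΩ, sub_zero]
      rw [hZker y _ hp, hZy, zero_apply] at heq
      exact sub_eq_zero.1 heq)
  have hpf : ∀ u ∈ ball (0 : EuclideanSpace ℝ (Fin d)) δ, p (f u) - u = p x₀ := by
    intro u hu
    have hder : ∀ w ∈ ball (0 : EuclideanSpace ℝ (Fin d)) δ,
        HasFDerivAt (fun w => p (f w) - w) (0 : EuclideanSpace ℝ (Fin d) →L[ℝ] _) w := fun w hw => by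
      have := (p.hasFDerivAt.comp w (hf w hw).2.2).sub (hasFDerivAt_id w)
      rwa [hpX _ (hbΩ (hf w hw).1), sub_self] at this
    have := (convex_ball (0 : EuclideanSpace ℝ (Fin d)) δ).is_const_of_fderivWithin_eq_zero (𝕜 := ℝ)
      (f := fun w => p (f w) - w)
      (fun w hw => (hder w hw).differentiableAt.differentiableWithinAt)
      (fun w hw => (hder w hw).hasFDerivWithinAt.fderivWithin
        (isOpen_ball.uniqueDiffWithinAt hw)) hu (mem_ball_self hδ)
    simpa [hf0] using this
  refine ⟨d, ball 0 δ, f, ⟨isOpen_ball, (convex_ball _ _).isConnected ⟨0, mem_ball_self hδ⟩,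
    contDiffOn_infty_of_hasFDerivAt_comp hXs isOpen_ball (fun u hu => hbΩ (hf u hu).1)
      (fun u hu => (hf u hu).2.2), fun u hu => (hf u hu).2.1.1, fun u hu v hv huv => ?_,
    fun u hu => ?_, fun u hu => ?_⟩, 0, mem_ball_self hδ, hf0⟩
  · have h1 := hpf u hu
    rw [huv, ← hpf v hv] at h1
    exact sub_right_injective h1
  · rw [(hf u hu).2.2.fderiv]
    intro v w hvw
    rw [← hpX' _ (hbΩ (hf u hu).1) v, ← hpX' _ (hbΩ (hf u hu).1) w, hvw]
  · obtain ⟨hfu, ⟨hfM, hfZ⟩, hd⟩ := hf u hu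
    rw [hd.fderiv, ← hD _ hfM]
    apply le_antisymm
    · rintro _ ⟨w, rfl⟩
      exact ⟨a (f u) w, by simp [hXdef, hRρ _ hfM (hbΩ hfu).1]⟩
    · rintro _ ⟨c, rfl⟩
      have := hZX (f u) c
      rw [hfZ, zero_apply, eq_comm, sub_eq_zero, hRρ _ hfM (hbΩ hfu).1] at this
      exact ⟨p (ρ (f u) c), this.symm⟩

theorem isIntegrableDistribution_of_involutive [FiniteDimensional ℝ E] [FiniteDimensional ℝ A]
    {M : Set E} {D : E → Submodule ℝ E} {ρ : E → A →L[ℝ] E}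
    (hret : IsLocalSmoothRetract M) (hρ : ContDiffOn ℝ ∞ ρ M)
    (hD : ∀ y ∈ M, (ρ y).range = D y)
    (htan : ∀ y ∈ M, ∀ c, ρ y c ∈ tangentConeAt ℝ M y)
    (hinv : ∀ x ∈ M, ∃ m : ℝ, ∀ᶠ y in 𝓝[M] x, ∃ ρ' : E →L[ℝ] A →L[ℝ] E,
      HasFDerivWithinAt ρ ρ' M y ∧
      ∀ c d, ∃ e, ‖e‖ ≤ m * ‖c‖ * ‖d‖ ∧ ρ' (ρ y c) d - ρ' (ρ y d) c = ρ y e) :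
    IsIntegrableDistribution M D := by
  refine ⟨fun x hx v hv => ?_, fun x hx => ?_⟩
  · rw [← hD x hx] at hv
    obtain ⟨c, rfl⟩ := hv
    refine ⟨fun y => ρ y c, hρ.clm_apply contDiffOn_const, fun y hy => ?_, rfl⟩
    rw [← hD y hy]
    exact ⟨c, rfl⟩
  · obtain ⟨m, hm⟩ := hinv x hx
    exact exists_integralPatch_of_involutive hret hρ hD htan hx hm

end Involutive

/-! ### The twistor space as a submanifold -/

section SkewPart

variable {R : Type*} [NormedRing R] [NormedAlgebra ℝ R] [StarRing R] [ContinuousStar R]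
  [StarModule ℝ R]

/-- Four times the projection onto the skew elements that anticommute
(`τ = 1`) or commute (`τ = -1`) with `L`. -/
noncomputable def skewPart (τ : ℝ) (L : R) : R →L[ℝ] R :=
  (ContinuousLinearMap.id ℝ _ + τ • ContinuousLinearMap.mulLeftRight ℝ R L L) ∘L
    (ContinuousLinearMap.id ℝ _ -
      ((starL' ℝ : R ≃L[ℝ] R) : R →L[ℝ] R))

theorem skewPart_apply (τ : ℝ) (L C : R) :
    skewPart τ L C = C - star C + τ • (L * (C - star C) * L) := by
  simp only [skewPart, ContinuousLinearMap.comp_apply, sub_apply, add_apply, smul_apply,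
    ContinuousLinearMap.id_apply, ContinuousLinearMap.mulLeftRight_apply,
    ContinuousLinearEquiv.coe_coe, starL'_apply]

theorem contDiff_skewPart {n : WithTop ℕ∞} (τ : ℝ) :
    ContDiff ℝ n (skewPart (R := R) τ) := by
  unfold skewPart
  refine ContDiff.clm_comp (contDiff_const.add (ContDiff.const_smul τ ?_)) contDiff_const
  exact ((ContinuousLinearMap.mulLeftRight ℝ R).contDiff).clm_apply contDiff_id

theorem star_skewPart {τ : ℝ} {L : R} (hL : star L = -L) (C : R) :
    star (skewPart τ L C) = -skewPart τ L C := by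
  rw [skewPart_apply]
  simp only [star_add, star_sub, star_smul, star_mul, star_star, hL, star_trivial]
  rw [neg_add, ← smul_neg]
  congr 1
  · abel
  · congr 1; noncomm_ring

theorem skewPart_mul {τ : ℝ} (hτ : τ * τ = 1) {L : R} (hL : L * L = -1) (C : R) :
    skewPart τ L C * L = -(τ • (L * skewPart τ L C)) := by
  rw [skewPart_apply]
  generalize C - star C = X
  have h1 : L * X * L * L = -(L * X) := by rw [mul_assoc, hL]; noncomm_ring
  have h2 : L * (L * X * L) = -(X * L) := by
    calc _ = (L * L) * X * L := by noncomm_ring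
      _ = _ := by rw [hL]; noncomm_ring
  rw [add_mul, mul_add, smul_mul_assoc, h1, mul_smul_comm, h2, smul_add, smul_smul, hτ, one_smul,
    smul_neg, neg_add, neg_neg, add_comm]

theorem skewPart_eq_smul {τ : ℝ} (hτ : τ * τ = 1) {L C : R} (hL : L * L = -1)
    (hs : star C = -C) (hC : C * L = -(τ • (L * C))) : skewPart τ L C = (4 : ℝ) • C := by
  rw [skewPart_apply, hs, sub_neg_eq_add]
  have : L * (C + C) * L = τ • (C + C) := by
    have : C * L + C * L = -(τ • (L * (C + C))) := by rw [hC, mul_add, smul_add]; abel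
    rw [mul_assoc, add_mul, this, mul_neg, mul_smul_comm, ← mul_assoc, hL]
    simp
  rw [this, smul_smul, hτ]
  module

end SkewPart

section Smooth

open Filter Topology

variable {V : Type*} [NormedAddCommGroup V] [InnerProductSpace ℝ V]
  {W : Type*} [NormedAddCommGroup W] [NormedSpace ℝ W]

theorem SmoothOnTwistor.hasFDerivWithinAt {f : (V →L[ℝ] V) → W} (hf : SmoothOnTwistor f)
    {K : V →L[ℝ] V} (hK : K ∈ twistorSpace V) :
    HasFDerivWithinAt f (fderivWithin ℝ f (twistorSpace V) K) (twistorSpace V) K :=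
  ((hf K hK).differentiableWithinAt (by simp)).hasFDerivWithinAt

theorem SmoothOnTwistor.exists_norm_le {f : (V →L[ℝ] V) → W} (hf : SmoothOnTwistor f) {K₀ : V →L[ℝ] V} (hK₀ : K₀ ∈ twistorSpace V) :
    ∃ m : ℝ, 0 ≤ m ∧ ∀ᶠ K in 𝓝[twistorSpace V] K₀, ‖f K‖ ≤ m :=
  ⟨‖f K₀‖ + 1, by positivity, ((hf K₀ hK₀).continuousWithinAt.norm.eventually
    (gt_mem_nhds (lt_add_one _))).mono fun _ h => h.le⟩

end Smooth

section TwistorManifold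

open Set Filter Topology

variable {V : Type*} [NormedAddCommGroup V] [InnerProductSpace ℝ V] [CompleteSpace V]

theorem mem_skewEnd_iff {A : V →L[ℝ] V} : A ∈ skewEnd V ↔ star A = -A := by
  rw [ContinuousLinearMap.star_eq_adjoint, eq_comm, ContinuousLinearMap.eq_adjoint_iff]
  change (∀ v w : V, inner ℝ (A v) w = -inner ℝ v (A w)) ↔ _
  simp only [neg_apply, inner_neg_left]
  exact forall₂_congr fun v w => neg_eq_iff_eq_neg.symm

theorem mem_twistorSpace_iff {K : V →L[ℝ] V} :
    K ∈ twistorSpace V ↔ K * K = -1 ∧ star K = -K := by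
  rw [← mem_skewEnd_iff]
  change (_ ∧ ∀ v w : V, inner ℝ (K v) (K w) = inner ℝ v w) ↔
    _ ∧ ∀ v w : V, inner ℝ (K v) w = -inner ℝ v (K w)
  refine and_congr_right fun h => ⟨fun h' v w => ?_, fun h' v w => ?_⟩
  · have : K (K w) = -w := DFunLike.congr_fun h w
    rw [← neg_eq_iff_eq_neg, ← inner_neg_right, ← this, h']
  · have : K (K w) = -w := DFunLike.congr_fun h w
    rw [h', this, inner_neg_right, neg_neg]

theorem mem_skewAnti_iff {A K : V →L[ℝ] V} :
    A ∈ skewAnti K ↔ star A = -A ∧ A * K = -(K * A) := by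
  rw [← mem_skewEnd_iff, ← add_eq_zero_iff_eq_neg]
  rfl

theorem mem_unitaryAlg_iff {B J : V →L[ℝ] V} :
    B ∈ unitaryAlg J ↔ star B = -B ∧ B * J = J * B := by
  rw [← mem_skewEnd_iff, ← sub_eq_zero]
  rfl

/-- The Cayley parametrization of the twistor space by `skewAnti K`. -/
theorem cayley_mem_twistorSpace {A K : V →L[ℝ] V} (hK : K ∈ twistorSpace V)
    (hA : A ∈ skewAnti K) (hu : IsUnit (1 + A)) :
    (1 + A) * K * Ring.inverse (1 + A) ∈ twistorSpace V := by
  obtain ⟨hK2, hKs⟩ := mem_twistorSpace_iff.1 hK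
  obtain ⟨hAs, hAK⟩ := mem_skewAnti_iff.1 hA
  have h1 : (1 + A) * Ring.inverse (1 + A) = 1 := Ring.mul_inverse_cancel _ hu
  have h2 : Ring.inverse (1 + A) * (1 + A) = 1 := Ring.inverse_mul_cancel _ hu
  have h3 : star (Ring.inverse (1 + A)) * (1 - A) = 1 := by
    have := congrArg star h1
    simpa [hAs, ← sub_eq_add_neg] using this
  generalize Ring.inverse (1 + A) = i at *
  refine mem_twistorSpace_iff.2 ⟨?_, ?_⟩
  · calc (1 + A) * K * i * ((1 + A) * K * i) = (1 + A) * K * (i * (1 + A)) * K * i := by noncomm_ring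
      _ = (1 + A) * (K * K) * i := by rw [h2]; noncomm_ring
      _ = -1 := by rw [hK2, mul_neg, mul_one, neg_mul, h1]
  · have hc : K * ((1 - A) * (1 + A)) = (1 - A) * (1 + A) * K := by
      have : A * A * K = K * (A * A) := by rw [mul_assoc, hAK, mul_neg, ← mul_assoc, hAK]; noncomm_ring
      calc K * ((1 - A) * (1 + A)) = K - K * (A * A) := by noncomm_ring
        _ = K - A * A * K := by rw [this]
        _ = _ := by noncomm_ring
    have : star i * K * (1 - A) = (1 + A) * K * i := by
      calc star i * K * (1 - A) = star i * K * (1 - A) * ((1 + A) * i) := by rw [h1, mul_one]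
        _ = star i * (K * ((1 - A) * (1 + A))) * i := by noncomm_ring
        _ = (star i * (1 - A)) * (1 + A) * K * i := by rw [hc]; noncomm_ring
        _ = _ := by rw [h3, one_mul]
    rw [← this, star_mul, star_mul, star_star, star_sub, star_one, hAs, hKs, this,
      sub_neg_eq_add]
    noncomm_ring

theorem cayley_inverse_mem_skewAnti {K₀ K : V →L[ℝ] V} (hK₀ : K₀ ∈ twistorSpace V)
    (hK : K ∈ twistorSpace V) (hu : IsUnit (K + K₀)) :
    (K - K₀) * Ring.inverse (K + K₀) ∈ skewAnti K₀ ∧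
      (1 + (K - K₀) * Ring.inverse (K + K₀)) * K₀ =
        K * (1 + (K - K₀) * Ring.inverse (K + K₀)) := by
  obtain ⟨hK2, hKs⟩ := mem_twistorSpace_iff.1 hK
  obtain ⟨hL2, hLs⟩ := mem_twistorSpace_iff.1 hK₀
  have h1 : (K + K₀) * Ring.inverse (K + K₀) = 1 := Ring.mul_inverse_cancel _ hu
  have h2 : Ring.inverse (K + K₀) * (K + K₀) = 1 := Ring.inverse_mul_cancel _ hu
  have h3 : star (Ring.inverse (K + K₀)) * (K + K₀) = -1 := by
    have := congrArg star h1
    rw [star_mul, star_add, hKs, hLs, star_one, ← neg_add, mul_neg, neg_eq_iff_eq_neg] at this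
    exact this
  generalize Ring.inverse (K + K₀) = i at *
  have hi : i * K₀ = K * i := by
    have : (K + K₀) * K = K₀ * (K + K₀) := by rw [add_mul, mul_add, hK2, hL2, add_comm]
    calc i * K₀ = i * K₀ * ((K + K₀) * i) := by rw [h1, mul_one]
      _ = i * (K₀ * (K + K₀)) * i := by noncomm_ring
      _ = i * (K + K₀) * (K * i) := by rw [← this]; noncomm_ring
      _ = _ := by rw [h2, one_mul]
  have hd : K₀ * (K - K₀) = -((K - K₀) * K) := by
    rw [mul_sub, sub_mul, hK2, hL2]; noncomm_ring
  have hs : star i = -i := by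
    calc star i = star i * ((K + K₀) * i) := by rw [h1, mul_one]
      _ = _ := by rw [← mul_assoc, h3, neg_one_mul]
  refine ⟨mem_skewAnti_iff.2 ⟨?_, ?_⟩, ?_⟩
  · have hc : (K - K₀) * (K + K₀) = -((K + K₀) * (K - K₀)) := by
      simp only [sub_mul, mul_add, add_mul, mul_sub, hK2, hL2]; abel
    rw [star_mul, star_sub, hKs, hLs, hs]
    calc -i * (-K - -K₀) = i * ((K - K₀) * (K + K₀)) * i := by
          rw [mul_assoc, mul_assoc, h1]; noncomm_ring
      _ = -((i * (K + K₀)) * ((K - K₀) * i)) := by rw [hc]; noncomm_ring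
      _ = _ := by rw [h2, one_mul]
  · rw [mul_assoc, hi, ← mul_assoc, ← mul_assoc, hd]; noncomm_ring
  · have hA : 1 + (K - K₀) * i = 2 • (K * i) := by
      calc 1 + (K - K₀) * i = (K + K₀) * i + (K - K₀) * i := by rw [h1]
        _ = _ := by noncomm_ring
    rw [hA, smul_mul_assoc, mul_assoc, hi, mul_smul_comm]

theorem skewAnti_subset_tangentConeAt {K : V →L[ℝ] V} (hK : K ∈ twistorSpace V) :
    (skewAnti K : Set (V →L[ℝ] V)) ⊆ tangentConeAt ℝ (twistorSpace V) K := by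
  intro B hB
  obtain ⟨hK2, hKs⟩ := mem_twistorSpace_iff.1 hK
  obtain ⟨hBs, hBK⟩ := mem_skewAnti_iff.1 hB
  set A : V →L[ℝ] V := -((1 / 2 : ℝ) • (B * K)) with hA
  have hAmem : A ∈ skewAnti K := by
    refine neg_mem (Submodule.smul_mem _ _ (mem_skewAnti_iff.2 ⟨?_, ?_⟩))
    · rw [star_mul, hKs, hBs, hBK]; noncomm_ring
    · rw [hBK, neg_mul, mul_assoc, hBK]
  have hcont : Continuous fun t : ℝ => 1 + t • A := by fun_prop
  have hopen : IsOpen ((fun t : ℝ => 1 + t • A) ⁻¹' {q | IsUnit q}) := Units.isOpen.preimage hcont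
  set U := (fun t : ℝ => 1 + t • A) ⁻¹' {q | IsUnit q} with hU
  have h0 : (0 : ℝ) ∈ U := by simp [hU]
  have hd1 : HasDerivAt (fun t : ℝ => 1 + t • A) A 0 := by
    simpa using ((hasDerivAt_id (0 : ℝ)).smul_const A).const_add 1
  have hd2 : HasDerivAt (fun t : ℝ => Ring.inverse (1 + t • A)) (-A) 0 := by
    have h := hasFDerivAt_ringInverse (𝕜 := ℝ) (1 : (V →L[ℝ] V)ˣ)
    have e : ((1 : (V →L[ℝ] V)ˣ) : V →L[ℝ] V) = 1 + (0 : ℝ) • A := by simp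
    rw [e] at h
    simpa [Function.comp_def] using! h.comp_hasDerivAt (0 : ℝ) hd1
  have hd : HasDerivAt (fun t : ℝ => (1 + t • A) * K * Ring.inverse (1 + t • A)) B 0 := by
    have h := (hd1.mul_const K).mul hd2
    have e : A * K * Ring.inverse (1 + (0 : ℝ) • A) + (1 + (0 : ℝ) • A) * K * (-A) = B := by
      have h1 : K * (B * K) = B := by rw [hBK, mul_neg, ← mul_assoc, hK2]; simp
      have h2 : B * K * K = -B := by rw [mul_assoc, hK2]; simp
      rw [zero_smul, add_zero, Ring.inverse_one, mul_one, one_mul, hA, neg_neg, mul_smul_comm, h1,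
        neg_mul, smul_mul_assoc, h2]
      module
    convert! h using 1
    exact e.symm
  have hmaps := (hd.hasDerivWithinAt (s := U)).hasFDerivWithinAt.mapsTo_tangent_cone
  have h1 : (1 : ℝ) ∈ tangentConeAt ℝ U 0 := by
    rw [tangentConeAt_of_mem_nhds (hopen.mem_nhds h0)]; trivial
  have := hmaps h1
  simp only [ContinuousLinearMap.toSpanSingleton_apply, one_smul, zero_smul, add_zero, one_mul,
    Ring.inverse_one, mul_one] at this
  refine tangentConeAt_mono ?_ this
  rintro _ ⟨t, ht, rfl⟩
  exact cayley_mem_twistorSpace hK (Submodule.smul_mem _ t hAmem) ht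

theorem isLocalSmoothRetract_twistorSpace : IsLocalSmoothRetract (twistorSpace V) := by
  intro K₀ hK₀
  obtain ⟨hL2, hLs⟩ := mem_twistorSpace_iff.1 hK₀
  set Ω₁ : Set (V →L[ℝ] V) := (fun X => X + K₀) ⁻¹' {q | IsUnit q} with hΩ₁
  have hΩ₁o : IsOpen Ω₁ := Units.isOpen.preimage (by fun_prop)
  have hinv : ∀ {g : (V →L[ℝ] V) → (V →L[ℝ] V)} {s : Set (V →L[ℝ] V)}, ContDiffOn ℝ ∞ g s →
      (∀ x ∈ s, IsUnit (g x)) → ContDiffOn ℝ ∞ (fun x => Ring.inverse (g x)) s := by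
    intro g s hg hs x hx
    obtain ⟨q, hq⟩ := hs x hx
    have := contDiffAt_ringInverse ℝ (n := ∞) q
    rw [hq] at this
    exact this.comp_contDiffWithinAt x (hg x hx)
  set α : (V →L[ℝ] V) → (V →L[ℝ] V) := fun X =>
    (1 / 4 : ℝ) • skewPart 1 K₀ ((X - K₀) * Ring.inverse (X + K₀)) with hα
  have hαs : ContDiffOn ℝ ∞ α Ω₁ := by
    refine ContDiffOn.const_smul _ ((skewPart 1 K₀).contDiff.comp_contDiffOn ?_)
    exact (contDiffOn_id.sub contDiffOn_const).mul
      (hinv (contDiffOn_id.add contDiffOn_const) fun x hx => hx)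
  have hαmem : ∀ X, α X ∈ skewAnti K₀ := fun X => by
    refine Submodule.smul_mem _ _ (mem_skewAnti_iff.2 ⟨star_skewPart hLs _, ?_⟩)
    simpa using skewPart_mul (τ := 1) (by norm_num) hL2 ((X - K₀) * Ring.inverse (X + K₀))
  have hαT : ∀ K ∈ twistorSpace V, K ∈ Ω₁ → α K = (K - K₀) * Ring.inverse (K + K₀) := by
    intro K hK hKΩ
    obtain ⟨h1, h2⟩ := mem_skewAnti_iff.1 (cayley_inverse_mem_skewAnti hK₀ hK hKΩ).1
    rw [hα]
    simp only
    rw [skewPart_eq_smul (by norm_num) hL2 h1 (by simpa using h2), smul_smul]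
    norm_num
  set Ω : Set (V →L[ℝ] V) := Ω₁ ∩ (fun X => 1 + α X) ⁻¹' {q | IsUnit q} with hΩ
  have hone : ContDiffOn ℝ ∞ (fun X => 1 + α X) Ω₁ := contDiffOn_const.add hαs
  have hK₀Ω₁ : K₀ ∈ Ω₁ := by
    have : IsUnit K₀ := ⟨⟨K₀, -K₀, by simp [hL2], by simp [hL2]⟩, rfl⟩
    have h2 : K₀ + K₀ = (Units.mk0 (2 : ℝ) two_ne_zero) • K₀ := by
      rw [Units.smul_mk0, two_smul]
    change IsUnit (K₀ + K₀)
    rw [h2]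
    exact this.smul _
  refine ⟨Ω, fun X => (1 + α X) * K₀ * Ring.inverse (1 + α X),
    hone.continuousOn.isOpen_inter_preimage hΩ₁o Units.isOpen, ⟨hK₀Ω₁, ?_⟩, ?_, ?_, ?_⟩
  · simp [hαT K₀ hK₀ hK₀Ω₁]
  · have h1 := hone.mono (inter_subset_left : Ω ⊆ Ω₁)
    exact (h1.mul contDiffOn_const).mul (hinv h1 fun x hx => hx.2)
  · exact fun X hX => cayley_mem_twistorSpace hK₀ (hαmem X) hX.2
  · intro K hK hKΩ
    have h := (cayley_inverse_mem_skewAnti hK₀ hK hKΩ.1).2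
    rw [← hαT K hK hKΩ.1] at h
    simp only
    rw [h, mul_assoc, Ring.mul_inverse_cancel _ hKΩ.2, mul_one]

variable {W : Type*} [NormedAddCommGroup W] [NormedSpace ℝ W]

/-- Tangential derivatives are determined by the values on the twistor space. -/
theorem HasFDerivWithinAt.dTwistor_eq {f : (V →L[ℝ] V) → W} {f' : (V →L[ℝ] V) →L[ℝ] W}
    {K B : V →L[ℝ] V} (hf : HasFDerivWithinAt f f' (twistorSpace V) K)
    (hK : K ∈ twistorSpace V) (hB : B ∈ skewAnti K) : dTwistor f K B = f' B :=
  hf.differentiableWithinAt.hasFDerivWithinAt.unique_on hf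
    (skewAnti_subset_tangentConeAt hK hB)

theorem HasFDerivWithinAt.apply_eq_of_eqOn {f g : (V →L[ℝ] V) → W}
    {f' g' : (V →L[ℝ] V) →L[ℝ] W} {K B : V →L[ℝ] V}
    (hf : HasFDerivWithinAt f f' (twistorSpace V) K)
    (hg : HasFDerivWithinAt g g' (twistorSpace V) K) (hfg : EqOn f g (twistorSpace V))
    (hK : K ∈ twistorSpace V) (hB : B ∈ skewAnti K) : f' B = g' B :=
  hf.unique_on (hg.congr hfg (hfg hK)) (skewAnti_subset_tangentConeAt hK hB)

theorem SmoothOnTwistor.exists_norm_dTwistor_le {f : (V →L[ℝ] V) → W} (hf : SmoothOnTwistor f)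
    {K₀ : V →L[ℝ] V} (hK₀ : K₀ ∈ twistorSpace V) :
    ∃ m : ℝ, 0 ≤ m ∧ ∀ᶠ K in 𝓝[twistorSpace V] K₀, ∀ B ∈ skewAnti K,
      ‖dTwistor f K B‖ ≤ m * ‖B‖ := by
  obtain ⟨Ω, r, hΩ, hxΩ, hr, hmaps, hid⟩ := isLocalSmoothRetract_twistorSpace K₀ hK₀
  have hs : ContDiffOn ℝ ∞ (f ∘ r) Ω := ContDiffOn.comp hf hr hmaps
  have hb := ((hs.fderiv_of_isOpen hΩ (by simp)).continuousAt_of_isOpen hΩ hxΩ).eventually_norm_le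
  refine ⟨‖fderiv ℝ (f ∘ r) K₀‖ + 1, by positivity, ?_⟩
  · filter_upwards [self_mem_nhdsWithin, mem_nhdsWithin_of_mem_nhds (hΩ.mem_nhds hxΩ),
      mem_nhdsWithin_of_mem_nhds hb] with K hK hKΩ hKb B hB
    rw [dTwistor, ← fderiv_comp_retract_apply hΩ hr hmaps hid hK hKΩ
      (skewAnti_subset_tangentConeAt hK hB) (hf.hasFDerivWithinAt hK)]
    exact ContinuousLinearMap.le_of_opNorm_le _ hKb B

end TwistorManifold

/-! ### Anchors built from a section of `End V` -/

section Anchor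

variable {R : Type*} [NormedRing R] [NormedAlgebra ℝ R] [StarRing R] [ContinuousStar R]
  [StarModule ℝ R]

/-- The map `C ↦ F * skewPart τ L C * F`. -/
noncomputable def anchor (τ : ℝ) (F L : R) : R →L[ℝ] R :=
  ContinuousLinearMap.mulLeftRight ℝ R F F ∘L skewPart τ L

theorem anchor_apply (τ : ℝ) (F L C : R) : anchor τ F L C = F * skewPart τ L C * F := by
  simp [anchor]

theorem anchor_eq_skewPart {τ ε : ℝ} {F L k : R} (hε : ε * ε = 1) (hF : star F = ε • F)
    (h1 : k * F = F * L) (h2 : F * k = L * F) (C : R) :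
    anchor τ F L C = skewPart τ k (F * C * F) := by
  have h3 : F * star C * F = star (F * C * F) := by
    rw [star_mul, star_mul, hF, smul_mul_assoc, mul_smul_comm, mul_smul_comm, smul_smul, hε,
      one_smul, mul_assoc]
  have h4 : F * (L * (C - star C) * L) * F = k * (F * (C - star C) * F) * k := by
    calc _ = (F * L) * (C - star C) * (L * F) := by noncomm_ring
      _ = _ := by rw [← h1, ← h2]; noncomm_ring
  rw [anchor_apply, skewPart_apply, skewPart_apply, mul_add, add_mul, mul_smul_comm,
    smul_mul_assoc, h4, mul_sub, sub_mul, h3]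

theorem anchor_smul_eq {τ ε : ℝ} (hτ : τ * τ = 1) {F L k : R} (hε : ε * ε = 1)
    (hF : star F = ε • F) (h1 : k * F = F * L) (h2 : F * k = L * F) (hk : k * k = -1) {C : R}
    (hs : star (F * C * F) = -(F * C * F))
    (hc : F * C * F * k = -(τ • (k * (F * C * F)))) :
    anchor τ F L ((1 / 4 : ℝ) • C) = F * C * F := by
  rw [map_smul, anchor_eq_skewPart hε hF h1 h2, skewPart_eq_smul hτ hk hs hc, smul_smul]
  norm_num

theorem star_anchor {τ ε : ℝ} {F L : R} (hε : ε * ε = 1) (hF : star F = ε • F)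
    (hL : star L = -L) (C : R) : star (anchor τ F L C) = -anchor τ F L C := by
  rw [anchor_apply, star_mul, star_mul, hF, star_skewPart hL, smul_mul_assoc, mul_smul_comm,
    mul_smul_comm, smul_smul, hε, one_smul]
  noncomm_ring

theorem anchor_mul {τ ε : ℝ} (hτ : τ * τ = 1) {F L k : R} (hε : ε * ε = 1) (hF : star F = ε • F)
    (h1 : k * F = F * L) (h2 : F * k = L * F) (hk : k * k = -1) (C : R) :
    anchor τ F L C * k = -(τ • (k * anchor τ F L C)) := by
  rw [anchor_eq_skewPart hε hF h1 h2, skewPart_mul hτ hk]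

variable {E : Type*} [NormedAddCommGroup E] [NormedSpace ℝ E]

theorem ContDiffOn.anchor {n : WithTop ℕ∞} {τ : ℝ} {F L : E → R} {s : Set E}
    (hF : ContDiffOn ℝ n F s) (hL : ContDiffOn ℝ n L s) :
    ContDiffOn ℝ n (fun x => anchor τ (F x) (L x)) s := by
  refine ContDiffOn.clm_comp ?_ ((contDiff_skewPart τ).comp_contDiffOn hL)
  exact ((ContinuousLinearMap.mulLeftRight ℝ R).contDiff.comp_contDiffOn hF).clm_apply hF

theorem HasFDerivWithinAt.exists_anchor {τ : ℝ} {F L : E → R} {F' L' : E →L[ℝ] R} {s : Set E}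
    {x : E} (hF : HasFDerivWithinAt F F' s x) (hL : HasFDerivWithinAt L L' s x) :
    ∃ β' : E →L[ℝ] R →L[ℝ] R, HasFDerivWithinAt (fun x => anchor τ (F x) (L x)) β' s x ∧
      ∀ X D, β' X D = F' X * skewPart τ (L x) D * F x +
        F x * (τ • (L' X * (D - star D) * L x + L x * (D - star D) * L' X)) * F x +
        F x * skewPart τ (L x) D * F' X := by
  have hmm : ∀ {G : E → R} {G' : E →L[ℝ] R}, HasFDerivWithinAt G G' s x →
      HasFDerivWithinAt (fun x => ContinuousLinearMap.mulLeftRight ℝ R (G x) (G x))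
        _ s x := fun hG =>
    ((ContinuousLinearMap.mulLeftRight ℝ R).hasFDerivAt.comp_hasFDerivWithinAt x hG).clm_apply hG
  have hsp : HasFDerivWithinAt (fun x => skewPart τ (L x)) _ s x :=
    ((((hmm hL).const_smul τ).const_add (ContinuousLinearMap.id ℝ R)).clm_comp
      (hasFDerivWithinAt_const _ _ _))
  refine ⟨_, (hmm hF).clm_comp hsp, fun X D => ?_⟩
  simp only [skewPart_apply, ContinuousLinearMap.comp_apply, add_apply, smul_apply,
    ContinuousLinearMap.flip_apply, ContinuousLinearMap.compL_apply,
    ContinuousLinearMap.mulLeftRight_apply, ContinuousLinearMap.comp_zero, zero_add,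
    sub_apply, ContinuousLinearMap.id_apply, ContinuousLinearEquiv.coe_coe, starL'_apply]
  simp only [mul_add, add_mul, mul_smul_comm, smul_mul_assoc, mul_sub, sub_mul, smul_sub,
    smul_add]
  abel

end Anchor

section Intertwiner

open Set Filter Topology

variable {V : Type*} [NormedAddCommGroup V] [InnerProductSpace ℝ V] [CompleteSpace V]

theorem norm_star_clm (A : V →L[ℝ] V) : ‖star A‖ = ‖A‖ :=
  LinearIsometryEquiv.norm_map ContinuousLinearMap.adjoint A

/-- `F` is a section of `End V` over the twistor space that is self-adjoint up to a sign, and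
that intertwines `φ` with `L` and `J` with `N`. -/
structure IsIntertwiner (J : V →L[ℝ] V) (F L N : (V →L[ℝ] V) → (V →L[ℝ] V)) (ε : ℝ) : Prop where
  sign : ε * ε = 1
  smooth : SmoothOnTwistor F
  smooth_left : SmoothOnTwistor L
  smooth_right : SmoothOnTwistor N
  left_mem : ∀ K ∈ twistorSpace V, L K ∈ twistorSpace V
  right_mem : ∀ K ∈ twistorSpace V, N K ∈ twistorSpace V
  star_eq : ∀ K ∈ twistorSpace V, star (F K) = ε • F K
  phi_mul : ∀ K ∈ twistorSpace V, K * F K = F K * L K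
  mul_phi : ∀ K ∈ twistorSpace V, F K * K = L K * F K
  J_mul : ∀ K ∈ twistorSpace V, J * F K = F K * N K
  mul_J : ∀ K ∈ twistorSpace V, F K * J = N K * F K

theorem exists_eq_mul_mul_of_ker_le [FiniteDimensional ℝ V] {F B : V →L[ℝ] V} {ε : ℝ}
    (hF : star F = ε • F) (hB : star B = -B) (hker : ∀ v, F v = 0 → B v = 0) :
    ∃ C, F * C * F = B := by
  obtain ⟨d, s, p, -, hsp⟩ := exists_section_projection F
  set G : V →L[ℝ] V := s ∘L p with hG
  have h1 : B * (G * F) = B := by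
    ext1 v
    have : F (v - G (F v)) = 0 := by simp [hG, hsp]
    have := hker _ this
    rw [map_sub, sub_eq_zero] at this
    exact this.symm
  have h2 : ε • (F * (star G * B)) = B := by
    have := congrArg star h1
    rw [star_mul, star_mul, hF, hB, mul_neg, neg_inj, smul_mul_assoc, smul_mul_assoc,
      mul_assoc] at this
    exact this
  refine ⟨ε • (star G * B * G), ?_⟩
  calc F * (ε • (star G * B * G)) * F = ε • (F * (star G * B)) * (G * F) := by
        simp only [mul_smul_comm, smul_mul_assoc, mul_assoc]
    _ = B := by rw [h2, h1]

theorem mem_range_anchor_iff [FiniteDimensional ℝ V] {τ ε : ℝ} (hτ : τ * τ = 1)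
    {F L k B : V →L[ℝ] V} (hε : ε * ε = 1) (hF : star F = ε • F) (h1 : k * F = F * L)
    (h2 : F * k = L * F) (hk : k * k = -1) (hL : star L = -L) :
    (∃ C, anchor τ F L C = B) ↔
      star B = -B ∧ B * k = -(τ • (k * B)) ∧ B ∈ kerZeroImStable F := by
  constructor
  · rintro ⟨C, rfl⟩
    refine ⟨star_anchor hε hF hL C, anchor_mul hτ hε hF h1 h2 hk C, ?_⟩
    rw [anchor_apply]
    exact ⟨fun v hv => by simp [hv], fun v => ⟨_, rfl⟩⟩
  · rintro ⟨hs, hc, hker, -⟩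
    obtain ⟨C, rfl⟩ := exists_eq_mul_mul_of_ker_le hF hs hker
    exact ⟨_, anchor_smul_eq hτ hε hF h1 h2 hk hs hc⟩

theorem exists_deriv_anchor {F L : (V →L[ℝ] V) → (V →L[ℝ] V)} {ε : ℝ} (τ : ℝ)
    (hFs : SmoothOnTwistor F) (hLs : SmoothOnTwistor L) (hε : ε * ε = 1)
    (hF : ∀ K ∈ twistorSpace V, star (F K) = ε • F K) {K₀ : V →L[ℝ] V}
    (hK₀ : K₀ ∈ twistorSpace V) :
    ∃ m : ℝ, 0 ≤ m ∧ ∀ᶠ K in 𝓝[twistorSpace V] K₀,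
      ∃ β' : (V →L[ℝ] V) →L[ℝ] (V →L[ℝ] V) →L[ℝ] (V →L[ℝ] V),
        HasFDerivWithinAt (fun K => anchor τ (F K) (L K)) β' (twistorSpace V) K ∧
        ∀ X ∈ skewAnti K, ∀ θ, dTwistor F K X = F K * θ → ∀ D, ∃ G,
          ‖G‖ ≤ m * (‖θ‖ + ‖X‖) * ‖D‖ ∧ β' X D = F K * G * F K := by
  obtain ⟨l, hl0, hl⟩ := hLs.exists_norm_le hK₀
  obtain ⟨l', hl'0, hl'⟩ := hLs.exists_norm_dTwistor_le hK₀
  have hsps : SmoothOnTwistor (fun K : V →L[ℝ] V => skewPart τ (L K)) :=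
    (contDiff_skewPart τ).comp_contDiffOn hLs
  obtain ⟨q, hq0, hq⟩ := hsps.exists_norm_le hK₀
  refine ⟨2 * q + 4 * |τ| * l' * l, by positivity, ?_⟩
  filter_upwards [self_mem_nhdsWithin, hl, hl', hq] with K hK hl hl' hq
  obtain ⟨β', hβ', hform⟩ := (hFs.hasFDerivWithinAt hK).exists_anchor (τ := τ)
    (hLs.hasFDerivWithinAt hK)
  refine ⟨β', hβ', fun X hX θ hθ D => ?_⟩
  have hθ' : dTwistor F K X = star θ * F K := by
    have h1 : HasFDerivWithinAt (fun K => star (F K)) _ (twistorSpace V) K :=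
      (starL' ℝ : (V →L[ℝ] V) ≃L[ℝ] (V →L[ℝ] V)).hasFDerivAt.comp_hasFDerivWithinAt K
        (hFs.hasFDerivWithinAt hK)
    have h2 : star (dTwistor F K X) = ε • dTwistor F K X :=
      h1.apply_eq_of_eqOn ((hFs.hasFDerivWithinAt hK).const_smul ε) hF hK hX
    calc dTwistor F K X = ε • (ε • dTwistor F K X) := by rw [smul_smul, hε, one_smul]
      _ = star θ * F K := by
        rw [← h2, hθ, star_mul, hF K hK, mul_smul_comm, smul_smul, hε, one_smul]
  set sD := skewPart τ (L K) D with hsD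
  set dL := dTwistor L K X with hdL
  have hsDn : ‖sD‖ ≤ q * ‖D‖ := ContinuousLinearMap.le_of_opNorm_le _ hq D
  have hdLn : ‖dL‖ ≤ l' * ‖X‖ := hl' X hX
  have hDn : ‖D - star D‖ ≤ 2 * ‖D‖ := by
    refine (norm_sub_le _ _).trans ?_
    rw [norm_star_clm]
    linarith
  refine ⟨θ * sD + τ • (dL * (D - star D) * L K + L K * (D - star D) * dL) + sD * star θ, ?_, ?_⟩
  · have e1 : ‖θ * sD‖ ≤ ‖θ‖ * (q * ‖D‖) := (norm_mul_le _ _).trans (by gcongr)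
    have e2 : ‖sD * star θ‖ ≤ (q * ‖D‖) * ‖θ‖ :=
      (norm_mul_le _ _).trans (by rw [norm_star_clm]; gcongr)
    have e3 : ‖dL * (D - star D) * L K‖ ≤ (l' * ‖X‖) * (2 * ‖D‖) * l :=
      (norm_mul₃_le).trans (by gcongr)
    have e4 : ‖L K * (D - star D) * dL‖ ≤ l * (2 * ‖D‖) * (l' * ‖X‖) :=
      (norm_mul₃_le).trans (by gcongr)
    have e5 : ‖τ • (dL * (D - star D) * L K + L K * (D - star D) * dL)‖ ≤
        |τ| * ((l' * ‖X‖) * (2 * ‖D‖) * l + l * (2 * ‖D‖) * (l' * ‖X‖)) := by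
      rw [norm_smul, Real.norm_eq_abs]
      gcongr
      exact (norm_add_le _ _).trans (add_le_add e3 e4)
    calc _ ≤ ‖θ‖ * (q * ‖D‖) + |τ| * ((l' * ‖X‖) * (2 * ‖D‖) * l + l * (2 * ‖D‖) * (l' * ‖X‖)) +
          (q * ‖D‖) * ‖θ‖ :=
          (norm_add_le _ _).trans (add_le_add ((norm_add_le _ _).trans (add_le_add e1 e5)) e2)
      _ = (2 * q * ‖θ‖ + 4 * |τ| * l' * l * ‖X‖) * ‖D‖ := by ring
      _ ≤ (2 * q * ‖θ‖ + 4 * |τ| * l' * l * ‖X‖ +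
          (2 * q * ‖X‖ + 4 * |τ| * l' * l * ‖θ‖)) * ‖D‖ := by
          refine mul_le_mul_of_nonneg_right ?_ (norm_nonneg D)
          exact le_add_of_nonneg_right (by positivity)
      _ = _ := by ring
  · rw [hform]
    change dTwistor F K X * sD * F K + _ + F K * sD * dTwistor F K X = _
    nth_rw 1 [hθ]
    rw [hθ']
    change F K * θ * sD * F K + F K * (τ • (dL * (D - star D) * L K + L K * (D - star D) * dL)) * F K
      + F K * sD * (star θ * F K) = _
    generalize τ • (dL * (D - star D) * L K + L K * (D - star D) * dL) = M
    noncomm_ring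

/-- The map `C ↦ [F * skewPart (-1) N C * F, K]`. -/
noncomputable def commAnchor (F N K : V →L[ℝ] V) : (V →L[ℝ] V) →L[ℝ] (V →L[ℝ] V) :=
  ((ContinuousLinearMap.mul ℝ (V →L[ℝ] V)).flip - ContinuousLinearMap.mul ℝ (V →L[ℝ] V)) K ∘L
    anchor (-1) F N

theorem commAnchor_apply (F N K C : V →L[ℝ] V) :
    commAnchor F N K C = anchor (-1) F N C * K - K * anchor (-1) F N C := by
  simp [commAnchor]

theorem commutator_mem_skewAnti {B K : V →L[ℝ] V} (hK : K ∈ twistorSpace V) (hB : star B = -B) :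
    B * K - K * B ∈ skewAnti K := by
  obtain ⟨hK2, hKs⟩ := mem_twistorSpace_iff.1 hK
  refine mem_skewAnti_iff.2 ⟨?_, ?_⟩
  · rw [star_sub, star_mul, star_mul, hB, hKs]; noncomm_ring
  · rw [sub_mul, mul_sub, mul_assoc, hK2, ← mul_assoc K K B, hK2]; noncomm_ring

end Intertwiner

section Integrability

open Set Filter Topology

variable {V : Type*} [NormedAddCommGroup V] [InnerProductSpace ℝ V] [CompleteSpace V]
  [FiniteDimensional ℝ V]

theorem isIntegrableDistribution_distF {J : V →L[ℝ] V} {F L N : (V →L[ℝ] V) → (V →L[ℝ] V)}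
    {ε : ℝ} (h : IsIntertwiner J F L N ε)
    (hθ : ∀ K₀ ∈ twistorSpace V, ∃ m : ℝ, 0 ≤ m ∧ ∀ᶠ K in 𝓝[twistorSpace V] K₀,
      ∀ C, star C = -C → C * L K = -(L K * C) →
        ∃ θ, ‖θ‖ ≤ m * ‖C‖ ∧ dTwistor F K (F K * C * F K) = F K * θ) :
    IsIntegrableDistribution (twistorSpace V) (distF F) := by
  have hmem : ∀ K ∈ twistorSpace V, ∀ B, (∃ C, anchor 1 (F K) (L K) C = B) ↔ B ∈ distF F K := by
    intro K hK B
    rw [mem_range_anchor_iff (τ := 1) (by norm_num) h.sign (h.star_eq K hK) (h.phi_mul K hK)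
      (h.mul_phi K hK) (mem_twistorSpace_iff.1 hK).1
      (mem_twistorSpace_iff.1 (h.left_mem K hK)).2, one_smul, ← and_assoc, ← mem_skewAnti_iff]
    rfl
  have htan : ∀ K ∈ twistorSpace V, ∀ C, anchor 1 (F K) (L K) C ∈ skewAnti K := fun K hK C =>
    ((hmem K hK _).1 ⟨C, rfl⟩).1
  have hsmooth : SmoothOnTwistor (fun K => anchor 1 (F K) (L K)) :=
    ContDiffOn.anchor h.smooth h.smooth_left
  refine isIntegrableDistribution_of_involutive (ρ := fun K => anchor 1 (F K) (L K))
    isLocalSmoothRetract_twistorSpace hsmooth (fun K hK => ?_)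
    (fun K hK C => skewAnti_subset_tangentConeAt hK (htan K hK C)) (fun K₀ hK₀ => ?_)
  · ext B
    exact hmem K hK B
  obtain ⟨m, hm0, hm⟩ := hθ K₀ hK₀
  obtain ⟨μ, hμ0, hμ⟩ := exists_deriv_anchor 1 h.smooth h.smooth_left h.sign h.star_eq hK₀
  have hsps : SmoothOnTwistor (fun K : V →L[ℝ] V => skewPart 1 (L K)) :=
    (contDiff_skewPart 1).comp_contDiffOn h.smooth_left
  obtain ⟨q, hq0, hq⟩ := hsps.exists_norm_le hK₀
  obtain ⟨a, ha0, ha⟩ := hsmooth.exists_norm_le hK₀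
  refine ⟨μ * (m * q + a), ?_⟩
  filter_upwards [self_mem_nhdsWithin, hm, hμ, hq, ha] with K hK hm hμ hq ha
  obtain ⟨β', hβ', hG⟩ := hμ
  have hL := mem_twistorSpace_iff.1 (h.left_mem K hK)
  have hK' := mem_twistorSpace_iff.1 hK
  refine ⟨β', hβ', fun C D => ?_⟩
  have hG' : ∀ C D, ∃ G, ‖G‖ ≤ μ * (m * q + a) * ‖C‖ * ‖D‖ ∧
      β' (anchor 1 (F K) (L K) C) D = F K * G * F K := by
    intro C D
    obtain ⟨θ, hθn, hθ⟩ := hm (skewPart 1 (L K) C) (star_skewPart hL.2 C)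
      (by simpa using skewPart_mul (τ := 1) (by norm_num) hL.1 C)
    obtain ⟨G, hGn, hGeq⟩ := hG _ (htan K hK C) θ (by rw [anchor_apply]; exact hθ) D
    refine ⟨G, hGn.trans ?_, hGeq⟩
    have h1 : ‖skewPart 1 (L K) C‖ ≤ q * ‖C‖ := ContinuousLinearMap.le_of_opNorm_le _ hq C
    have h2 : ‖anchor 1 (F K) (L K) C‖ ≤ a * ‖C‖ := ContinuousLinearMap.le_of_opNorm_le _ ha C
    calc μ * (‖θ‖ + ‖anchor 1 (F K) (L K) C‖) * ‖D‖ ≤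
        μ * (m * (q * ‖C‖) + a * ‖C‖) * ‖D‖ := by
          gcongr
          exact hθn.trans (by gcongr)
      _ = _ := by ring
  obtain ⟨G₁, hn₁, hG₁⟩ := hG' C D
  obtain ⟨G₂, hn₂, hG₂⟩ := hG' D C
  have hstar : ∀ X ∈ skewAnti K, ∀ D, star (β' X D) = -β' X D := by
    intro X hX D
    have h0 : HasFDerivWithinAt (fun K => anchor 1 (F K) (L K) D) _ (twistorSpace V) K :=
      hβ'.clm_apply (hasFDerivWithinAt_const D K _)
    have h1 : HasFDerivWithinAt (fun K => star (anchor 1 (F K) (L K) D)) _ (twistorSpace V) K :=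
      (starL' ℝ : (V →L[ℝ] V) ≃L[ℝ] (V →L[ℝ] V)).hasFDerivAt.comp_hasFDerivWithinAt K h0
    simpa using h1.apply_eq_of_eqOn h0.neg (fun K hK => star_anchor h.sign (h.star_eq K hK)
      (mem_twistorSpace_iff.1 (h.left_mem K hK)).2 D) hK hX
  have hanti : ∀ X ∈ skewAnti K, ∀ D, β' X D * K + anchor 1 (F K) (L K) D * X =
      -(K * β' X D + X * anchor 1 (F K) (L K) D) := by
    intro X hX D
    have h0 : HasFDerivWithinAt (fun K => anchor 1 (F K) (L K) D) _ (twistorSpace V) K :=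
      hβ'.clm_apply (hasFDerivWithinAt_const D K _)
    have h1 := h0.mul' (hasFDerivWithinAt_id K (twistorSpace V))
    have h2 := ((hasFDerivWithinAt_id K (twistorSpace V)).mul' h0).neg
    have := h1.apply_eq_of_eqOn h2 (fun K hK => by
      simpa using anchor_mul (τ := 1) (by norm_num) h.sign (h.star_eq K hK) (h.phi_mul K hK)
        (h.mul_phi K hK) (mem_twistorSpace_iff.1 hK).1 D) hK hX
    simpa [add_comm] using this
  have hbr : β' (anchor 1 (F K) (L K) C) D - β' (anchor 1 (F K) (L K) D) C =
      F K * (G₁ - G₂) * F K := by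
    rw [hG₁, hG₂]; noncomm_ring
  refine ⟨(1 / 4 : ℝ) • (G₁ - G₂), ?_, ?_⟩
  · rw [norm_smul]
    have : ‖G₁ - G₂‖ ≤ _ := (norm_sub_le _ _).trans (add_le_add hn₁ hn₂)
    have h0 := norm_nonneg (G₁ - G₂)
    norm_num
    nlinarith
  · have hs : star (F K * (G₁ - G₂) * F K) = -(F K * (G₁ - G₂) * F K) := by
      rw [← hbr, star_sub, hstar _ (htan K hK C), hstar _ (htan K hK D)]
      abel
    have hc : F K * (G₁ - G₂) * F K * K = -((1 : ℝ) • (K * (F K * (G₁ - G₂) * F K))) := by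
      have e1 := hanti _ (htan K hK C) D
      have e2 := hanti _ (htan K hK D) C
      rw [← hbr, one_smul, sub_mul, mul_sub, eq_sub_of_add_eq e1, eq_sub_of_add_eq e2]
      abel
    rw [anchor_smul_eq (by norm_num) h.sign (h.star_eq K hK) (h.phi_mul K hK) (h.mul_phi K hK)
      hK'.1 hs hc]
    exact hbr

set_option maxHeartbeats 1000000 in
theorem isIntegrableDistribution_distU {J : V →L[ℝ] V} (hJ : J ∈ twistorSpace V)
    {F L N : (V →L[ℝ] V) → (V →L[ℝ] V)} {ε : ℝ} (h : IsIntertwiner J F L N ε)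
    (hθ : ∀ K₀ ∈ twistorSpace V, ∃ m : ℝ, 0 ≤ m ∧ ∀ᶠ K in 𝓝[twistorSpace V] K₀,
      ∀ C, star C = -C → C * N K = N K * C →
        ∃ θ, ‖θ‖ ≤ m * ‖C‖ ∧
          dTwistor F K (F K * C * F K * K - K * (F K * C * F K)) = F K * θ) :
    IsIntegrableDistribution (twistorSpace V) (distU J F) := by
  have hJ' := mem_twistorSpace_iff.1 hJ
  have hmem : ∀ K ∈ twistorSpace V, ∀ B, (∃ C, anchor (-1) (F K) (N K) C = B) ↔
      B ∈ unitaryAlg J ⊓ kerZeroImStable (F K) := by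
    intro K hK B
    rw [mem_range_anchor_iff (τ := -1) (by norm_num) h.sign (h.star_eq K hK) (h.J_mul K hK)
      (h.mul_J K hK) hJ'.1 (mem_twistorSpace_iff.1 (h.right_mem K hK)).2, neg_one_smul, neg_neg,
      ← and_assoc, ← mem_unitaryAlg_iff]
    rfl
  have hstarβ : ∀ K ∈ twistorSpace V, ∀ C,
      star (anchor (-1) (F K) (N K) C) = -anchor (-1) (F K) (N K) C := fun K hK C =>
    star_anchor h.sign (h.star_eq K hK) (mem_twistorSpace_iff.1 (h.right_mem K hK)).2 C
  have htan : ∀ K ∈ twistorSpace V, ∀ C, commAnchor (F K) (N K) K C ∈ skewAnti K := fun K hK C => by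
    rw [commAnchor_apply]
    exact commutator_mem_skewAnti hK (hstarβ K hK C)
  have hβs : SmoothOnTwistor (fun K => anchor (-1) (F K) (N K)) :=
    ContDiffOn.anchor h.smooth h.smooth_right
  have hsmooth : SmoothOnTwistor (fun K => commAnchor (F K) (N K) K) :=
    (ContinuousLinearMap.contDiff _).contDiffOn.clm_comp hβs
  refine isIntegrableDistribution_of_involutive (ρ := fun K => commAnchor (F K) (N K) K)
    isLocalSmoothRetract_twistorSpace hsmooth (fun K hK => ?_)
    (fun K hK C => skewAnti_subset_tangentConeAt hK (htan K hK C)) (fun K₀ hK₀ => ?_)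
  · ext X
    constructor
    · rintro ⟨C, rfl⟩
      exact ⟨_, (hmem K hK _).1 ⟨C, rfl⟩, (commAnchor_apply _ _ _ _).symm⟩
    · rintro ⟨B, hB, rfl⟩
      obtain ⟨C, rfl⟩ := (hmem K hK B).2 hB
      exact ⟨C, commAnchor_apply _ _ _ _⟩
  obtain ⟨m, hm0, hm⟩ := hθ K₀ hK₀
  obtain ⟨μ, hμ0, hμ⟩ := exists_deriv_anchor (-1) h.smooth h.smooth_right h.sign h.star_eq hK₀
  have hsps : SmoothOnTwistor (fun K : V →L[ℝ] V => skewPart (-1) (N K)) :=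
    (contDiff_skewPart (-1)).comp_contDiffOn h.smooth_right
  obtain ⟨q, hq0, hq⟩ := hsps.exists_norm_le hK₀
  obtain ⟨a, ha0, ha⟩ := hsmooth.exists_norm_le hK₀
  obtain ⟨b, hb0, hb⟩ := h.smooth.exists_norm_le hK₀
  refine ⟨μ * (m * q + a) + q * b * b * q, ?_⟩
  filter_upwards [self_mem_nhdsWithin, hm, hμ, hq, ha, hb] with K hK hm hμ hq ha hb
  obtain ⟨β', hβ', hG⟩ := hμ
  have hN := mem_twistorSpace_iff.1 (h.right_mem K hK)
  have hqn : ∀ C, ‖skewPart (-1) (N K) C‖ ≤ q * ‖C‖ := fun C =>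
    ContinuousLinearMap.le_of_opNorm_le _ hq C
  obtain ⟨ρ', hρ', hρform⟩ : ∃ ρ' : (V →L[ℝ] V) →L[ℝ] (V →L[ℝ] V) →L[ℝ] (V →L[ℝ] V),
      HasFDerivWithinAt (fun K => commAnchor (F K) (N K) K) ρ' (twistorSpace V) K ∧
      ∀ X D, ρ' X D = β' X D * K - K * β' X D +
        (anchor (-1) (F K) (N K) D * X - X * anchor (-1) (F K) (N K) D) :=
    ⟨_, (ContinuousLinearMap.hasFDerivWithinAt _).clm_comp hβ', fun X D => by simp⟩
  refine ⟨ρ', hρ', fun C D => ?_⟩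
  have hG' : ∀ C D, ∃ G, ‖G‖ ≤ μ * (m * q + a) * ‖C‖ * ‖D‖ ∧
      β' (commAnchor (F K) (N K) K C) D = F K * G * F K := by
    intro C D
    obtain ⟨θ, hθn, hθ⟩ := hm (skewPart (-1) (N K) C) (star_skewPart hN.2 C)
      (by simpa using skewPart_mul (τ := -1) (by norm_num) hN.1 C)
    obtain ⟨G, hGn, hGeq⟩ := hG _ (htan K hK C) θ
      (by rw [commAnchor_apply, anchor_apply]; exact hθ) D
    refine ⟨G, hGn.trans ?_, hGeq⟩
    have h2 : ‖commAnchor (F K) (N K) K C‖ ≤ a * ‖C‖ := ContinuousLinearMap.le_of_opNorm_le _ ha C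
    calc μ * (‖θ‖ + ‖commAnchor (F K) (N K) K C‖) * ‖D‖ ≤
        μ * (m * (q * ‖C‖) + a * ‖C‖) * ‖D‖ := by
          gcongr
          exact hθn.trans (by gcongr; exact hqn C)
      _ = _ := by ring
  obtain ⟨G₁, hn₁, hG₁⟩ := hG' C D
  obtain ⟨G₂, hn₂, hG₂⟩ := hG' D C
  have hderiv : ∀ D, HasFDerivWithinAt (fun K => anchor (-1) (F K) (N K) D) (β'.flip D)
      (twistorSpace V) K := fun D => by
    have := hβ'.clm_apply (hasFDerivWithinAt_const D K (twistorSpace V))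
    simpa using this
  have hstar : ∀ X ∈ skewAnti K, ∀ D, star (β' X D) = -β' X D := by
    intro X hX D
    have h1 : HasFDerivWithinAt (fun K => star (anchor (-1) (F K) (N K) D)) _ (twistorSpace V) K :=
      (starL' ℝ : (V →L[ℝ] V) ≃L[ℝ] (V →L[ℝ] V)).hasFDerivAt.comp_hasFDerivWithinAt K (hderiv D)
    simpa using h1.apply_eq_of_eqOn (hderiv D).neg (fun K hK => hstarβ K hK D) hK hX
  have hcomm : ∀ X ∈ skewAnti K, ∀ D, β' X D * J = J * β' X D := by
    intro X hX D
    have h1 := (hderiv D).mul_const' J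
    have h2 := (hderiv D).const_mul J
    have := h1.apply_eq_of_eqOn h2 (fun K hK => by
      simpa using anchor_mul (τ := -1) (by norm_num) h.sign (h.star_eq K hK) (h.J_mul K hK)
        (h.mul_J K hK) hJ'.1 D) hK hX
    simpa using this
  set c := skewPart (-1) (N K) C with hc
  set d := skewPart (-1) (N K) D with hd
  set G := G₁ - G₂ - (c * F K * F K * d - d * F K * F K * c) with hGdef
  set βC := anchor (-1) (F K) (N K) C with hβC
  set βD := anchor (-1) (F K) (N K) D with hβD
  set XC := commAnchor (F K) (N K) K C with hXC
  set XD := commAnchor (F K) (N K) K D with hXD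
  have hb' : F K * G * F K = β' XC D - β' XD C - (βC * βD - βD * βC) := by
    rw [hG₁, hG₂, hβC, hβD, anchor_apply, anchor_apply, ← hc, ← hd, hGdef]
    noncomm_ring
  have hβJ : ∀ C, anchor (-1) (F K) (N K) C * J = J * anchor (-1) (F K) (N K) C := fun C => by
    simpa using anchor_mul (τ := -1) (by norm_num) h.sign (h.star_eq K hK) (h.J_mul K hK)
        (h.mul_J K hK) hJ'.1 C
  have hs : star (F K * G * F K) = -(F K * G * F K) := by
    have e1 : star (β' XC D) = -β' XC D := hstar _ (htan K hK C) D
    have e2 : star (β' XD C) = -β' XD C := hstar _ (htan K hK D) C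
    have e3 : star βC = -βC := hstarβ K hK C
    have e4 : star βD = -βD := hstarβ K hK D
    rw [hb', star_sub, star_sub, star_sub, star_mul, star_mul, e1, e2, e3, e4]
    noncomm_ring
  have hcJ : F K * G * F K * J = J * (F K * G * F K) := by
    have e1 := hcomm _ (htan K hK C) D
    have e2 := hcomm _ (htan K hK D) C
    have e3 : βC * J = J * βC := hβJ C
    have e4 : βD * J = J * βD := hβJ D
    rw [hb', sub_mul, sub_mul, sub_mul, mul_sub, mul_sub, mul_sub, e1, e2, mul_assoc, mul_assoc,
      e3, e4, ← mul_assoc βC, ← mul_assoc βD, e3, e4, mul_assoc, mul_assoc]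
  refine ⟨(1 / 4 : ℝ) • G, ?_, ?_⟩
  · have hcn : ‖c‖ ≤ q * ‖C‖ := hqn C
    have hdn : ‖d‖ ≤ q * ‖D‖ := hqn D
    have e1 : ‖c * F K * F K * d‖ ≤ (q * ‖C‖) * b * b * (q * ‖D‖) :=
      (norm_mul_le _ _).trans (mul_le_mul ((norm_mul₃_le).trans (by gcongr)) hdn (by positivity)
        (by positivity))
    have e2 : ‖d * F K * F K * c‖ ≤ (q * ‖D‖) * b * b * (q * ‖C‖) :=
      (norm_mul_le _ _).trans (mul_le_mul ((norm_mul₃_le).trans (by gcongr)) hcn (by positivity)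
        (by positivity))
    have e3 : ‖G‖ ≤ _ := (norm_sub_le _ _).trans (add_le_add
      ((norm_sub_le _ _).trans (add_le_add hn₁ hn₂))
      ((norm_sub_le _ _).trans (add_le_add e1 e2)))
    have h0 := norm_nonneg G
    rw [norm_smul]
    norm_num
    nlinarith
  · change ρ' XC D - ρ' XD C = commAnchor (F K) (N K) K ((1 / 4 : ℝ) • G)
    rw [commAnchor_apply, anchor_smul_eq (by norm_num) h.sign (h.star_eq K hK) (h.J_mul K hK)
      (h.mul_J K hK) hJ'.1 hs (by simpa using hcJ), hb', hρform, hρform, ← hβC, ← hβD]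
    have eC : XC = βC * K - K * βC := commAnchor_apply _ _ _ _
    have eD : XD = βD * K - K * βD := commAnchor_apply _ _ _ _
    generalize β' XC D = u at *
    generalize β' XD C = v at *
    rw [eC, eD]
    noncomm_ring

end Integrability

/-! ### The basic sections -/

section BasicSections

open Set Filter Topology

variable {V : Type*} [NormedAddCommGroup V] [InnerProductSpace ℝ V] [CompleteSpace V]

/-- The common structure of the four basic sections: `S` intertwines `φ` with `L` and `J` with `N`,
and has constant derivative `σ`, where `σ` and conjugation by `S` are related by `κ`. -/
structure IsTwistorSection (J : V →L[ℝ] V) (S L N : (V →L[ℝ] V) → (V →L[ℝ] V))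
    (σ κ : (V →L[ℝ] V) →L[ℝ] (V →L[ℝ] V)) (ε : ℝ) : Prop extends IsIntertwiner J S L N ε where
  hasFDerivAt : ∀ K, HasFDerivAt S σ K
  comm : ∀ K q : V →L[ℝ] V, q * J = J * q → q * K = K * q →
    q * S K = S K * q ∧ q * L K = L K * q ∧ q * N K = N K * q
  commutator_eq : ∀ K q : V →L[ℝ] V, q * J = J * q → q * S K - S K * q = σ (q * K - K * q)
  map_mul_right : ∀ Y q : V →L[ℝ] V, q * J = J * q → σ (Y * q) = σ Y * q
  map_mul_left : ∀ Y q : V →L[ℝ] V, q * J = J * q → σ (q * Y) = q * σ Y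
  map_sandwich : ∀ K ∈ twistorSpace V, ∀ C, σ (S K * C * S K) = S K * κ C * S K

theorem neg_mem_twistorSpace {K : V →L[ℝ] V} (hK : K ∈ twistorSpace V) : -K ∈ twistorSpace V := by
  obtain ⟨h1, h2⟩ := mem_twistorSpace_iff.1 hK
  exact mem_twistorSpace_iff.2 ⟨by rw [neg_mul_neg, h1], by rw [star_neg, h2]⟩

theorem exists_isTwistorSection {J : V →L[ℝ] V} (hJ : J ∈ twistorSpace V)
    {S : (V →L[ℝ] V) → (V →L[ℝ] V)} (hS : S ∈ basicSections J) :
    ∃ L N σ κ ε, IsTwistorSection J S L N σ κ ε := by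
  obtain ⟨hJ2, hJs⟩ := mem_twistorSpace_iff.1 hJ
  have hconst : SmoothOnTwistor (fun _ : V →L[ℝ] V => J) := contDiffOn_const
  have hid : SmoothOnTwistor (fun K : V →L[ℝ] V => K) := contDiffOn_id
  have hJK : ∀ K : V →L[ℝ] V, J * (J * K) = -K := fun K => by rw [← mul_assoc, hJ2, neg_one_mul]
  rcases hS with rfl | rfl | rfl | rfl
  · refine ⟨fun K => K, fun _ => J, 0, 0, 1, ⟨⟨by norm_num, contDiffOn_const, hid, hconst,
      fun K hK => hK, fun K hK => hJ, ?_, ?_, ?_, ?_, ?_⟩, ?_, ?_, ?_, ?_, ?_, ?_⟩⟩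
    · simp
    · simp
    · simp
    · simp
    · simp
    · exact fun K => hasFDerivAt_const _ _
    · exact fun K q h1 h2 => ⟨by simp, h2, h1⟩
    all_goals simp
  · refine ⟨fun _ => J, fun K => K, ContinuousLinearMap.id ℝ _, ContinuousLinearMap.id ℝ _, -1,
      ⟨⟨by norm_num, contDiffOn_const.add contDiffOn_id, hconst, hid,
      fun K hK => hJ, fun K hK => hK, ?_, ?_, ?_, ?_, ?_⟩, ?_, ?_, ?_, ?_, ?_, ?_⟩⟩
    · intro K hK
      rw [star_add, hJs, (mem_twistorSpace_iff.1 hK).2, neg_one_smul, neg_add]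
    · intro K hK
      rw [mul_add, add_mul, (mem_twistorSpace_iff.1 hK).1, hJ2, add_comm]
    · intro K hK
      rw [mul_add, add_mul, (mem_twistorSpace_iff.1 hK).1, hJ2, add_comm]
    · intro K hK
      rw [mul_add, add_mul, (mem_twistorSpace_iff.1 hK).1, hJ2, add_comm]
    · intro K hK
      rw [mul_add, add_mul, (mem_twistorSpace_iff.1 hK).1, hJ2, add_comm]
    · exact fun K => (hasFDerivAt_id K).const_add J
    · exact fun K q h1 h2 => ⟨by rw [mul_add, add_mul, h1, h2], h1, h2⟩
    · intro K q h
      simp only [ContinuousLinearMap.id_apply, mul_add, add_mul, h]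
      abel
    all_goals simp
  · refine ⟨fun _ => -J, fun K => -K, -ContinuousLinearMap.id ℝ _, -ContinuousLinearMap.id ℝ _, -1,
      ⟨⟨by norm_num, contDiffOn_const.sub contDiffOn_id, hconst.neg, hid.neg,
      fun K hK => neg_mem_twistorSpace hJ, fun K hK => neg_mem_twistorSpace hK,
      ?_, ?_, ?_, ?_, ?_⟩, ?_, ?_, ?_, ?_, ?_, ?_⟩⟩
    · intro K hK
      rw [star_sub, hJs, (mem_twistorSpace_iff.1 hK).2, neg_one_smul]
      abel
    · intro K hK
      rw [mul_sub, sub_mul, (mem_twistorSpace_iff.1 hK).1, mul_neg, mul_neg, hJ2]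
      abel
    · intro K hK
      rw [mul_sub, sub_mul, (mem_twistorSpace_iff.1 hK).1, neg_mul, neg_mul, hJ2]
      abel
    · intro K hK
      rw [mul_sub, sub_mul, mul_neg, mul_neg, (mem_twistorSpace_iff.1 hK).1, hJ2]
      abel
    · intro K hK
      rw [mul_sub, sub_mul, neg_mul, neg_mul, (mem_twistorSpace_iff.1 hK).1, hJ2]
      abel
    · exact fun K => (hasFDerivAt_id K).const_sub J
    · exact fun K q h1 h2 => ⟨by rw [mul_sub, sub_mul, h1, h2], by rw [mul_neg, neg_mul, h1],
        by rw [mul_neg, neg_mul, h2]⟩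
    · intro K q h
      simp only [ContinuousLinearMap.id_apply, neg_apply, mul_sub, sub_mul, h]
      abel
    all_goals simp
  · set σ : (V →L[ℝ] V) →L[ℝ] (V →L[ℝ] V) :=
      ContinuousLinearMap.mul ℝ (V →L[ℝ] V) J - (ContinuousLinearMap.mul ℝ (V →L[ℝ] V)).flip J
      with hσ
    have hσa : ∀ X, σ X = J * X - X * J := fun X => by simp [hσ]
    have hσe : (fun K => J * K - K * J) = σ := by ext1 X; rw [hσa]
    refine ⟨fun K => -K, fun K => -J, σ, -σ, -1,
      ⟨⟨by norm_num, ?_, hid.neg, hconst.neg,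
      fun K hK => neg_mem_twistorSpace hK, fun K hK => neg_mem_twistorSpace hJ,
      ?_, ?_, ?_, ?_, ?_⟩, ?_, ?_, ?_, ?_, ?_, ?_⟩⟩
    · rw [hσe]; exact σ.contDiff.contDiffOn
    · intro K hK
      rw [star_sub, star_mul, star_mul, hJs, (mem_twistorSpace_iff.1 hK).2, neg_one_smul]
      noncomm_ring
    · intro K hK
      have hK2 := (mem_twistorSpace_iff.1 hK).1
      rw [mul_neg, mul_sub, sub_mul, mul_assoc, hK2, ← mul_assoc K K, hK2, mul_assoc K J K]
      noncomm_ring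
    · intro K hK
      have hK2 := (mem_twistorSpace_iff.1 hK).1
      rw [neg_mul, mul_sub, sub_mul, mul_assoc, hK2, ← mul_assoc K K, hK2, mul_assoc K J K]
      noncomm_ring
    · intro K hK
      rw [mul_neg, mul_sub, sub_mul, hJK, mul_assoc K, hJ2, mul_assoc J K J]
      noncomm_ring
    · intro K hK
      rw [neg_mul, mul_sub, sub_mul, hJK, mul_assoc K, hJ2, mul_assoc J K J]
      noncomm_ring
    · intro K
      rw [hσe]; exact σ.hasFDerivAt
    · refine fun K q h1 h2 => ⟨?_, by rw [mul_neg, neg_mul, h2], by rw [mul_neg, neg_mul, h1]⟩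
      calc q * (J * K - K * J) = (q * J) * K - (q * K) * J := by noncomm_ring
        _ = (J * q) * K - (K * q) * J := by rw [h1, h2]
        _ = J * (q * K) - K * (q * J) := by noncomm_ring
        _ = _ := by rw [h1, h2]; noncomm_ring
    · intro K q h
      rw [hσa]
      calc _ = (q * J) * K - q * K * J - J * K * q + K * (J * q) := by noncomm_ring
        _ = (J * q) * K - q * K * J - J * K * q + K * (q * J) := by rw [h]
        _ = _ := by noncomm_ring
    · intro Y q h
      rw [hσa, hσa, sub_mul, mul_assoc Y q, h]
      noncomm_ring
    · intro Y q h
      rw [hσa, hσa, mul_sub, ← mul_assoc J q, ← h]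
      noncomm_ring
    · intro K hK C
      have h1 : J * (J * K - K * J) = -((J * K - K * J) * J) := by
        rw [mul_sub, sub_mul, hJK, mul_assoc K, hJ2, mul_assoc J K J]
        noncomm_ring
      rw [hσa, neg_apply, hσa]
      generalize J * K - K * J = s at *
      have h2 : s * J = -(J * s) := by rw [h1, neg_neg]
      calc J * (s * C * s) - s * C * s * J = (J * s) * C * s - s * C * (s * J) := by noncomm_ring
        _ = -(s * J) * C * s - s * C * -(J * s) := by rw [← h1, ← h2]
        _ = _ := by noncomm_ring

theorem IsAdmissible.star_eq {J K : V →L[ℝ] V} {Q : (V →L[ℝ] V) → (V →L[ℝ] V)}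
    (hQ : IsAdmissible J Q) (hK : K ∈ twistorSpace V) : star (Q K) = Q K := by
  rw [ContinuousLinearMap.star_eq_adjoint, eq_comm, ContinuousLinearMap.eq_adjoint_iff]
  exact hQ.selfAdjoint K hK

theorem IsTwistorSection.isIntertwiner_mul {J : V →L[ℝ] V} {S L N : (V →L[ℝ] V) → (V →L[ℝ] V)}
    {σ κ : (V →L[ℝ] V) →L[ℝ] (V →L[ℝ] V)} {ε : ℝ} (h : IsTwistorSection J S L N σ κ ε)
    {Q : (V →L[ℝ] V) → (V →L[ℝ] V)} (hQ : IsAdmissible J Q) :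
    IsIntertwiner J (fun K => Q K * S K) L N ε := by
  have hc : ∀ K ∈ twistorSpace V, _ := fun K hK => h.comm K (Q K) (hQ.comm_J K hK) (hQ.comm_phi K hK)
  refine ⟨h.sign, hQ.smooth.mul h.smooth, h.smooth_left, h.smooth_right, h.left_mem, h.right_mem,
    fun K hK => ?_, fun K hK => ?_, fun K hK => ?_, fun K hK => ?_, fun K hK => ?_⟩
  · have hs : star (Q K) = Q K := hQ.star_eq hK
    rw [star_mul, hs, h.star_eq K hK, smul_mul_assoc, (hc K hK).1]
  · rw [← mul_assoc, ← hQ.comm_phi K hK, mul_assoc, h.phi_mul K hK, mul_assoc]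
  · rw [mul_assoc, h.mul_phi K hK, ← mul_assoc, (hc K hK).2.1, mul_assoc]
  · rw [← mul_assoc, ← hQ.comm_J K hK, mul_assoc, h.J_mul K hK, mul_assoc]
  · rw [mul_assoc, h.mul_J K hK, ← mul_assoc, (hc K hK).2.2, mul_assoc]

theorem mul_mul_mem_skewAnti {K Y q : V →L[ℝ] V} (hq : star q = q) (hqK : q * K = K * q)
    (hY : Y ∈ skewAnti K) : q * Y * q ∈ skewAnti K := by
  obtain ⟨h1, h2⟩ := mem_skewAnti_iff.1 hY
  refine mem_skewAnti_iff.2 ⟨?_, ?_⟩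
  · rw [star_mul, star_mul, hq, h1]; noncomm_ring
  · rw [mul_assoc, hqK, ← mul_assoc, mul_assoc q Y K, h2, mul_neg, ← mul_assoc q K, hqK]
    noncomm_ring

/-- Along `F * C * F`, for `F = Q S`, the derivative of `F` is a right multiple of `F`. -/
theorem IsTwistorSection.exists_dTwistor_eq_mul {J : V →L[ℝ] V}
    {S L N : (V →L[ℝ] V) → (V →L[ℝ] V)}
    {σ κ : (V →L[ℝ] V) →L[ℝ] (V →L[ℝ] V)} {ε : ℝ} (h : IsTwistorSection J S L N σ κ ε)
    {Q : (V →L[ℝ] V) → (V →L[ℝ] V)} (hQ : IsAdmissible J Q)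
    {D : (V →L[ℝ] V) → Submodule ℝ (V →L[ℝ] V)} (hD : ∀ K ∈ twistorSpace V, D K ≤ skewAnti K)
    (hQD : QCondition Q D) {K₀ : V →L[ℝ] V} (hK₀ : K₀ ∈ twistorSpace V) :
    ∃ m : ℝ, 0 ≤ m ∧ ∀ᶠ K in 𝓝[twistorSpace V] K₀, ∀ C, S K * C * S K ∈ D K →
      ∃ θ, ‖θ‖ ≤ m * ‖C‖ ∧
        dTwistor (fun K => Q K * S K) K (Q K * S K * C * (Q K * S K)) = Q K * S K * θ := by
  obtain ⟨a, ha0, ha⟩ := hQ.smooth.exists_norm_dTwistor_le hK₀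
  obtain ⟨b, hb0, hb⟩ := hQ.smooth.exists_norm_le hK₀
  obtain ⟨c, hc0, hc⟩ := h.smooth.exists_norm_le hK₀
  refine ⟨a * (c * c) * b + ‖κ‖ * c * (b * b), by positivity, ?_⟩
  filter_upwards [self_mem_nhdsWithin, ha, hb, hc] with K hK ha hb hc C hC
  set Y := S K * C * S K with hY
  have hYt : Y ∈ skewAnti K := hD K hK hC
  have hqJ := hQ.comm_J K hK
  have hqK := hQ.comm_phi K hK
  have hqS := (h.comm K (Q K) hqJ hqK).1
  have hqs : star (Q K) = Q K := hQ.star_eq hK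
  have hXY : Q K * S K * C * (Q K * S K) = Q K * Y * Q K := by
    calc _ = Q K * (S K * C) * (Q K * S K) := by noncomm_ring
      _ = Q K * (S K * C) * (S K * Q K) := by rw [hqS]
      _ = _ := by rw [hY]; noncomm_ring
  have hXt : Q K * Y * Q K ∈ skewAnti K := mul_mul_mem_skewAnti hqs hqK hYt
  have hQd := hQ.smooth.hasFDerivWithinAt hK
  have hdJ : dTwistor Q K Y * J = J * dTwistor Q K Y := by
    have h1 := hQd.mul_const' J
    have h2 := hQd.const_mul J
    simpa using! h1.apply_eq_of_eqOn h2 (fun K hK => hQ.comm_J K hK) hK hYt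
  have hdK : dTwistor Q K Y * K - K * dTwistor Q K Y = Y * Q K - Q K * Y := by
    have h1 := hQd.mul' (hasFDerivWithinAt_id K (twistorSpace V))
    have h2 := (hasFDerivWithinAt_id K (twistorSpace V)).mul' hQd
    have h3 : Q K * Y + dTwistor Q K Y * K = K * dTwistor Q K Y + Y * Q K := by
      simpa using! h1.apply_eq_of_eqOn h2 (fun K hK => hQ.comm_phi K hK) hK hYt
    rw [sub_eq_sub_iff_add_eq_add, add_comm, h3, add_comm]
  have hF : dTwistor (fun K => Q K * S K) K (Q K * Y * Q K) =
      Q K * σ (Q K * Y * Q K) + dTwistor Q K (Q K * Y * Q K) * S K :=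
    (hQd.mul' (h.hasFDerivAt K).hasFDerivWithinAt).dTwistor_eq hK hXt
  refine ⟨dTwistor Q K Y * Q K + κ C * S K * (Q K * Q K), ?_, ?_⟩
  · have e0 : ‖Y‖ ≤ c * ‖C‖ * c := (norm_mul₃_le).trans (by gcongr)
    have e1 : ‖dTwistor Q K Y * Q K‖ ≤ a * (c * ‖C‖ * c) * b :=
      (norm_mul_le _ _).trans (by gcongr; exact (ha Y hYt).trans (by gcongr))
    have e2 : ‖κ C * S K * (Q K * Q K)‖ ≤ ‖κ‖ * ‖C‖ * c * (b * b) :=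
      (norm_mul₃_le).trans (by
        gcongr
        · exact κ.le_opNorm C
        · exact (norm_mul_le _ _).trans (by gcongr))
    calc _ ≤ a * (c * ‖C‖ * c) * b + ‖κ‖ * ‖C‖ * c * (b * b) :=
          (norm_add_le _ _).trans (add_le_add e1 e2)
      _ = _ := by ring
  · have hcs := h.commutator_eq K (dTwistor Q K Y) hdJ
    rw [hdK, map_sub, h.map_mul_right _ _ hqJ, h.map_mul_left _ _ hqJ] at hcs
    have hκ : σ Y = S K * κ C * S K := h.map_sandwich K hK C
    rw [hXY, hF, hQD K hK Y hC, h.map_mul_right _ _ hqJ, h.map_mul_left _ _ hqJ]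
    have e1 : dTwistor Q K Y * S K = S K * dTwistor Q K Y + (σ Y * Q K - Q K * σ Y) :=
      sub_eq_iff_eq_add'.1 hcs
    have e2 : Q K * dTwistor Q K Y * Q K * S K = Q K * (dTwistor Q K Y * S K) * Q K := by
      rw [mul_assoc _ (Q K) (S K), hqS]; noncomm_ring
    rw [e2, e1]
    generalize dTwistor Q K Y = δ
    calc _ = Q K * S K * δ * Q K + Q K * σ Y * (Q K * Q K) := by noncomm_ring
      _ = _ := by rw [hκ]; noncomm_ring

end BasicSections

/-! ### Integrability of the distributions -/

section PolynomialSections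

open Filter Topology

variable {V : Type*} [NormedAddCommGroup V] [InnerProductSpace ℝ V]

theorem isAdmissible_one (J : V →L[ℝ] V) : IsAdmissible J (fun _ => 1) :=
  ⟨contDiffOn_const, fun _ _ _ _ => rfl, fun _ _ => by simp, fun _ _ => by simp⟩

theorem qCondition_one (D : (V →L[ℝ] V) → Submodule ℝ (V →L[ℝ] V)) :
    QCondition (fun _ => 1) D := fun K _ B _ => by simp [dTwistor]

theorem ConstantAlongLeaves.annihilatedAlong {a : (V →L[ℝ] V) → ℝ}
    {D : (V →L[ℝ] V) → Submodule ℝ (V →L[ℝ] V)} (ha : SmoothOnTwistor a)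
    (hD : IsIntegrableDistribution (twistorSpace V) D)
    (hc : ConstantAlongLeaves (twistorSpace V) D a) : AnnihilatedAlong a D := by
  intro K hK B hB
  obtain ⟨d, U, f, hf, u, hu, rfl⟩ := hD.2 K hK
  rw [← hf.tangent u hu] at hB
  obtain ⟨w, rfl⟩ := hB
  have h1 : HasFDerivAt f (fderiv ℝ f u) u :=
    ((hf.contDiffOn.contDiffAt (hf.isOpen.mem_nhds hu)).differentiableAt (by simp)).hasFDerivAt
  have h2 : HasFDerivAt (a ∘ f) (fderivWithin ℝ a (twistorSpace V) (f u) ∘L fderiv ℝ f u) u :=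
    ((ha.hasFDerivWithinAt hK).comp u h1.hasFDerivWithinAt hf.mapsTo).hasFDerivAt
      (hf.isOpen.mem_nhds hu)
  have h3 : HasFDerivAt (a ∘ f) (0 : EuclideanSpace ℝ (Fin d) →L[ℝ] ℝ) u := by
    refine (hasFDerivAt_const (a (f u)) u).congr_of_eventuallyEq ?_
    filter_upwards [hf.isOpen.mem_nhds hu] with v hv
    exact hc _ hK _ (.rel _ _ ⟨d, U, f, hf, ⟨u, hu, rfl⟩, ⟨v, hv, rfl⟩⟩)
  exact DFunLike.congr_fun (h2.unique h3) w

theorem antiComm_commute {J K : V →L[ℝ] V} (hJ : J * J = -1) (hK : K * K = -1) :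
    Commute (antiComm J K) J ∧ Commute (antiComm J K) K := by
  constructor
  · change (J * K + K * J) * J = J * (J * K + K * J)
    rw [add_mul, mul_add, mul_assoc K, ← mul_assoc J J, hJ]
    noncomm_ring
  · change (J * K + K * J) * K = K * (J * K + K * J)
    rw [add_mul, mul_add, mul_assoc J, ← mul_assoc K K, hK]
    noncomm_ring

theorem contDiff_antiComm (J : V →L[ℝ] V) : ContDiff ℝ ∞ (antiComm J) :=
  (contDiff_const.mul contDiff_id).add (contDiff_id.mul contDiff_const)

theorem polyQ_comm (J : V →L[ℝ] V) {k : ℕ} (a : Fin (k + 1) → (V →L[ℝ] V) → ℝ) {K q : V →L[ℝ] V}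
    (hq : Commute (antiComm J K) q) : polyQ J a K * q = q * polyQ J a K :=
  Commute.sum_left _ _ _ fun i _ => (hq.pow_left i).smul_left (a i K)

theorem exists_hasFDerivAt_antiComm_pow (J K : V →L[ℝ] V) (n : ℕ) :
    ∃ p : (V →L[ℝ] V) →L[ℝ] (V →L[ℝ] V), HasFDerivAt (fun K => antiComm J K ^ n) p K ∧
      ∀ q B, q * J = J * q → Commute q (antiComm J K) → p (q * B * q) = q * p B * q := by
  induction n with
  | zero => exact ⟨0, by simpa using hasFDerivAt_const _ _, by simp⟩
  | succ n ih =>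
    obtain ⟨p, hp, hpq⟩ := ih
    obtain ⟨A, hA⟩ : ∃ A : (V →L[ℝ] V) →L[ℝ] (V →L[ℝ] V), ∀ X, A X = antiComm J X :=
      ⟨ContinuousLinearMap.mul ℝ (V →L[ℝ] V) J + (ContinuousLinearMap.mul ℝ (V →L[ℝ] V)).flip J,
        fun X => by simp [antiComm]⟩
    have h1 : HasFDerivAt (antiComm J) A K := by
      rw [← funext hA]
      exact A.hasFDerivAt
    refine ⟨_, (hp.mul' h1).congr_of_eventuallyEq (.of_forall fun K => pow_succ _ n),
      fun q B hJ hq => ?_⟩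
    change antiComm J K ^ n * A (q * B * q) + p (q * B * q) * antiComm J K =
      q * (antiComm J K ^ n * A B + p B * antiComm J K) * q
    have h2 : A (q * B * q) = q * A B * q := by
      rw [hA, hA, antiComm, antiComm]
      calc _ = (J * q) * B * q + q * B * (q * J) := by noncomm_ring
        _ = (q * J) * B * q + q * B * (J * q) := by rw [hJ]
        _ = _ := by noncomm_ring
    have h3 : antiComm J K ^ n * q = q * antiComm J K ^ n := (hq.pow_right n).symm.eq
    rw [hpq q B hJ hq, h2]
    calc _ = (antiComm J K ^ n * q) * A B * q + q * p B * (q * antiComm J K) := by noncomm_ring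
      _ = _ := by rw [h3, hq.eq]; noncomm_ring

theorem mul_mul_mem_kerZeroImStable {F B q : V →L[ℝ] V} (hq : q * F = F * q)
    (hB : B ∈ kerZeroImStable F) : q * B * q ∈ kerZeroImStable F := by
  have h : ∀ v, q (F v) = F (q v) := fun v => DFunLike.congr_fun hq v
  refine ⟨fun v hv => ?_, fun v => ?_⟩
  · have : B (q v) = 0 := hB.1 _ (by rw [← h, hv, map_zero])
    simp [this]
  · obtain ⟨w, hw⟩ := hB.2 (q v)
    exact ⟨q w, by simp [h, hw]⟩

end PolynomialSections

section Main

open Set Filter Topology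

variable {V : Type*} [NormedAddCommGroup V] [InnerProductSpace ℝ V] [CompleteSpace V]

theorem distU_le_skewAnti {J K : V →L[ℝ] V} (F : (V →L[ℝ] V) → (V →L[ℝ] V))
    (hK : K ∈ twistorSpace V) : distU J F K ≤ skewAnti K := by
  rintro _ ⟨B, hB, rfl⟩
  exact commutator_mem_skewAnti hK (mem_unitaryAlg_iff.1 hB.1).1

theorem IsTwistorSection.isIntegrableDistribution_distF [FiniteDimensional ℝ V] {J : V →L[ℝ] V}
    {S L N : (V →L[ℝ] V) → (V →L[ℝ] V)} {σ κ : (V →L[ℝ] V) →L[ℝ] (V →L[ℝ] V)} {ε : ℝ}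
    (h : IsTwistorSection J S L N σ κ ε) {Q : (V →L[ℝ] V) → (V →L[ℝ] V)} (hQ : IsAdmissible J Q)
    (hQD : QCondition Q (distF S)) :
    IsIntegrableDistribution (twistorSpace V) (distF (fun K => Q K * S K)) := by
  refine _root_.isIntegrableDistribution_distF (h.isIntertwiner_mul hQ) fun K₀ hK₀ => ?_
  obtain ⟨m, hm0, hm⟩ := h.exists_dTwistor_eq_mul hQ (fun K _ => inf_le_left) hQD hK₀
  refine ⟨m, hm0, ?_⟩
  filter_upwards [self_mem_nhdsWithin, hm] with K hK hm C hCs hCL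
  refine hm C ⟨mem_skewAnti_iff.2 ⟨?_, ?_⟩, fun v hv => by simp [hv], fun v => ⟨_, rfl⟩⟩
  · rw [star_mul, star_mul, h.star_eq K hK, hCs, smul_mul_assoc, mul_smul_comm, mul_smul_comm,
      smul_smul, h.sign, one_smul]
    noncomm_ring
  · calc S K * C * S K * K = S K * C * (S K * K) := by noncomm_ring
      _ = S K * (C * L K) * S K := by rw [h.mul_phi K hK]; noncomm_ring
      _ = -((S K * L K) * C * S K) := by rw [hCL]; noncomm_ring
      _ = _ := by rw [← h.phi_mul K hK]; noncomm_ring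

theorem IsTwistorSection.isIntegrableDistribution_distU [FiniteDimensional ℝ V] {J : V →L[ℝ] V}
    (hJ : J ∈ twistorSpace V)
    {S L N : (V →L[ℝ] V) → (V →L[ℝ] V)} {σ κ : (V →L[ℝ] V) →L[ℝ] (V →L[ℝ] V)} {ε : ℝ}
    (h : IsTwistorSection J S L N σ κ ε) {Q : (V →L[ℝ] V) → (V →L[ℝ] V)} (hQ : IsAdmissible J Q)
    (hQD : QCondition Q (distU J S)) :
    IsIntegrableDistribution (twistorSpace V) (distU J (fun K => Q K * S K)) := by
  have hF := h.isIntertwiner_mul hQ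
  refine _root_.isIntegrableDistribution_distU hJ hF fun K₀ hK₀ => ?_
  obtain ⟨m, hm0, hm⟩ := h.exists_dTwistor_eq_mul hQ (fun K hK => distU_le_skewAnti S hK) hQD hK₀
  obtain ⟨l, hl0, hl⟩ := h.smooth_left.exists_norm_le hK₀
  refine ⟨m * (2 * l), by positivity, ?_⟩
  filter_upwards [self_mem_nhdsWithin, hm, hl] with K hK hm hl C hCs hCN
  have hsand : ∀ {G : V →L[ℝ] V}, K * G = G * L K → G * K = L K * G →
      G * C * G * K - K * (G * C * G) = G * (C * L K - L K * C) * G := by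
    intro G h1 h2
    calc _ = G * C * (G * K) - (K * G) * C * G := by noncomm_ring
      _ = _ := by rw [h1, h2]; noncomm_ring
  obtain ⟨θ, hθn, hθ⟩ := hm (C * L K - L K * C) (by
    refine ⟨S K * C * S K, ⟨mem_unitaryAlg_iff.2 ⟨?_, ?_⟩, fun v hv => by simp [hv],
      fun v => ⟨_, rfl⟩⟩, hsand (h.phi_mul K hK) (h.mul_phi K hK)⟩
    · rw [star_mul, star_mul, h.star_eq K hK, hCs, smul_mul_assoc, mul_smul_comm, mul_smul_comm,
        smul_smul, h.sign, one_smul]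
      noncomm_ring
    · calc S K * C * S K * J = S K * C * (S K * J) := by noncomm_ring
        _ = S K * (C * N K) * S K := by rw [h.mul_J K hK]; noncomm_ring
        _ = (S K * N K) * C * S K := by rw [hCN]; noncomm_ring
        _ = _ := by rw [← h.J_mul K hK]; noncomm_ring)
  refine ⟨θ, hθn.trans ?_, ?_⟩
  · have e : ‖C * L K - L K * C‖ ≤ ‖C‖ * l + l * ‖C‖ :=
      (norm_sub_le _ _).trans (add_le_add ((norm_mul_le _ _).trans (by gcongr))
        ((norm_mul_le _ _).trans (by gcongr)))
    calc _ ≤ m * (‖C‖ * l + l * ‖C‖) := by gcongr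
      _ = _ := by ring
  · rw [hsand (hF.phi_mul K hK) (hF.mul_phi K hK)]
    exact hθ

theorem isAdmissible_polyQ {J : V →L[ℝ] V} (hJ : J ∈ twistorSpace V) {k : ℕ}
    {a : Fin (k + 1) → (V →L[ℝ] V) → ℝ} (ha : ∀ i, SmoothOnTwistor (a i)) :
    IsAdmissible J (polyQ J a) := by
  obtain ⟨hJ2, hJs⟩ := mem_twistorSpace_iff.1 hJ
  refine ⟨?_, fun K hK => ?_, fun K hK => ?_, fun K hK => ?_⟩
  · exact ContDiffOn.sum fun i _ => (ha i).smul ((contDiff_antiComm J).pow i).contDiffOn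
  · have hs : star (polyQ J a K) = polyQ J a K := by
      have : star (antiComm J K) = antiComm J K := by
        rw [antiComm, star_add, star_mul, star_mul, hJs, (mem_twistorSpace_iff.1 hK).2]
        noncomm_ring
      simp only [polyQ, star_sum, star_smul, star_pow, this, star_trivial]
    rw [ContinuousLinearMap.star_eq_adjoint, eq_comm, ContinuousLinearMap.eq_adjoint_iff] at hs
    exact hs
  · exact polyQ_comm J a (antiComm_commute hJ2 (mem_twistorSpace_iff.1 hK).1).1
  · exact polyQ_comm J a (antiComm_commute hJ2 (mem_twistorSpace_iff.1 hK).1).2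

theorem qCondition_polyQ {J : V →L[ℝ] V} (hJ : J ∈ twistorSpace V) {k : ℕ}
    {a : Fin (k + 1) → (V →L[ℝ] V) → ℝ} (ha : ∀ i, SmoothOnTwistor (a i))
    {D : (V →L[ℝ] V) → Submodule ℝ (V →L[ℝ] V)} (hD : ∀ K ∈ twistorSpace V, D K ≤ skewAnti K)
    (hstable : ∀ K ∈ twistorSpace V, ∀ B ∈ D K, ∀ q : V →L[ℝ] V, star q = q → q * J = J * q →
      q * K = K * q → q * B * q ∈ D K) (haD : ∀ i, AnnihilatedAlong (a i) D) :
    QCondition (polyQ J a) D := by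
  intro K hK B hB
  have hQ := isAdmissible_polyQ hJ ha
  have hs := hQ.star_eq hK
  set q := polyQ J a K with hq
  have hqJ : q * J = J * q := hQ.comm_J K hK
  have hqK : q * K = K * q := hQ.comm_phi K hK
  choose p hp hpq using exists_hasFDerivAt_antiComm_pow J K
  have hcomm : Commute q (antiComm J K) := polyQ_comm J a (Commute.refl _)
  have hform : ∀ B ∈ D K, dTwistor (polyQ J a) K B = ∑ i, a i K • p i B := by
    intro B hB
    have h1 : HasFDerivWithinAt (polyQ J a) _ (twistorSpace V) K :=
      HasFDerivWithinAt.fun_sum fun i (_ : i ∈ Finset.univ) =>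
        ((ha i).hasFDerivWithinAt hK).smul (hp i).hasFDerivWithinAt
    rw [h1.dTwistor_eq hK (hD K hK hB), sum_apply]
    refine Finset.sum_congr rfl fun i _ => ?_
    have h2 : fderivWithin ℝ (a i) (twistorSpace V) K B = 0 := haD i K hK B hB
    simp [h2]
  rw [hform _ (hstable K hK B hB q hs hqJ hqK), hform B hB, Finset.mul_sum, Finset.sum_mul]
  refine Finset.sum_congr rfl fun i _ => ?_
  rw [hpq i q B hqJ hcomm, mul_smul_comm, smul_mul_assoc]

theorem IsTwistorSection.mul_mul_mem_distF {J K : V →L[ℝ] V}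
    {S L N : (V →L[ℝ] V) → (V →L[ℝ] V)} {σ κ : (V →L[ℝ] V) →L[ℝ] (V →L[ℝ] V)} {ε : ℝ}
    (h : IsTwistorSection J S L N σ κ ε) {B q : V →L[ℝ] V} (hB : B ∈ distF S K) (hs : star q = q)
    (hqJ : q * J = J * q) (hqK : q * K = K * q) : q * B * q ∈ distF S K :=
  ⟨mul_mul_mem_skewAnti hs hqK hB.1, mul_mul_mem_kerZeroImStable (h.comm K q hqJ hqK).1 hB.2⟩

theorem IsTwistorSection.mul_mul_mem_distU {J K : V →L[ℝ] V}
    {S L N : (V →L[ℝ] V) → (V →L[ℝ] V)} {σ κ : (V →L[ℝ] V) →L[ℝ] (V →L[ℝ] V)} {ε : ℝ}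
    (h : IsTwistorSection J S L N σ κ ε) {B q : V →L[ℝ] V} (hB : B ∈ distU J S K)
    (hs : star q = q) (hqJ : q * J = J * q) (hqK : q * K = K * q) : q * B * q ∈ distU J S K := by
  obtain ⟨B, ⟨hBu, hBk⟩, rfl⟩ := hB
  obtain ⟨h1, h2⟩ := mem_unitaryAlg_iff.1 hBu
  refine ⟨q * B * q, ⟨mem_unitaryAlg_iff.2 ⟨?_, ?_⟩,
    mul_mul_mem_kerZeroImStable (h.comm K q hqJ hqK).1 hBk⟩, ?_⟩
  · rw [star_mul, star_mul, hs, h1]; noncomm_ring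
  · calc q * B * q * J = q * B * (q * J) := by noncomm_ring
      _ = q * (B * J) * q := by rw [hqJ]; noncomm_ring
      _ = (q * J) * B * q := by rw [h2]; noncomm_ring
      _ = _ := by rw [hqJ]; noncomm_ring
  · change q * B * q * K - K * (q * B * q) = q * (B * K - K * B) * q
    calc _ = q * B * (q * K) - (K * q) * B * q := by noncomm_ring
      _ = q * B * (K * q) - (q * K) * B * q := by rw [hqK]
      _ = _ := by noncomm_ring

end Main

theorem theorem5p2 {V : Type*} [NormedAddCommGroup V] [InnerProductSpace ℝ V]
    [FiniteDimensional ℝ V] (J : V →L[ℝ] V) (hJ : J ∈ twistorSpace V)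
    (S : (V →L[ℝ] V) → (V →L[ℝ] V)) (hS : S ∈ basicSections J) :
    -- general `Q`
    (∀ Q : (V →L[ℝ] V) → (V →L[ℝ] V), IsAdmissible J Q →
      (QCondition Q (distF S) →
        IsIntegrableDistribution (twistorSpace V) (distF (fun K => Q K * S K))) ∧
      (QCondition Q (distU J S) →
        IsIntegrableDistribution (twistorSpace V) (distU J (fun K => Q K * S K)))) ∧
    -- `Q` polynomial in `{J, φ}`
    (∀ (k : ℕ) (a : Fin (k + 1) → (V →L[ℝ] V) → ℝ), (∀ i, SmoothOnTwistor (a i)) →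
      ((∀ i, AnnihilatedAlong (a i) (distF S)) →
        IsIntegrableDistribution (twistorSpace V) (distF (fun K => polyQ J a K * S K))) ∧
      ((∀ i, AnnihilatedAlong (a i) (distU J S)) →
        IsIntegrableDistribution (twistorSpace V) (distU J (fun K => polyQ J a K * S K)))) ∧
    -- `𝒟^S` and `𝒟^S_{𝔲(J)}` are integrable, and the polynomial case in terms of their leaves
    IsIntegrableDistribution (twistorSpace V) (distF S) ∧
    IsIntegrableDistribution (twistorSpace V) (distU J S) ∧
    (∀ (k : ℕ) (a : Fin (k + 1) → (V →L[ℝ] V) → ℝ), (∀ i, SmoothOnTwistor (a i)) →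
      ((∀ i, ConstantAlongLeaves (twistorSpace V) (distF S) (a i)) →
        IsIntegrableDistribution (twistorSpace V) (distF (fun K => polyQ J a K * S K))) ∧
      ((∀ i, ConstantAlongLeaves (twistorSpace V) (distU J S) (a i)) →
        IsIntegrableDistribution (twistorSpace V) (distU J (fun K => polyQ J a K * S K)))) := by
  have : CompleteSpace V := FiniteDimensional.complete ℝ V
  obtain ⟨L, N, σ, κ, ε, h⟩ := exists_isTwistorSection hJ hS
  have hF : ∀ K ∈ twistorSpace V, distF S K ≤ skewAnti K := fun K _ => inf_le_left
  have hU : ∀ K ∈ twistorSpace V, distU J S K ≤ skewAnti K := fun K hK => distU_le_skewAnti S hK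
  have hpF : ∀ (k : ℕ) (a : Fin (k + 1) → (V →L[ℝ] V) → ℝ), (∀ i, SmoothOnTwistor (a i)) →
      (∀ i, AnnihilatedAlong (a i) (distF S)) →
        IsIntegrableDistribution (twistorSpace V) (distF (fun K => polyQ J a K * S K)) :=
    fun k a ha haD => h.isIntegrableDistribution_distF (isAdmissible_polyQ hJ ha)
      (qCondition_polyQ hJ ha hF (fun K _ B hB q => h.mul_mul_mem_distF hB) haD)
  have hpU : ∀ (k : ℕ) (a : Fin (k + 1) → (V →L[ℝ] V) → ℝ), (∀ i, SmoothOnTwistor (a i)) →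
      (∀ i, AnnihilatedAlong (a i) (distU J S)) →
        IsIntegrableDistribution (twistorSpace V) (distU J (fun K => polyQ J a K * S K)) :=
    fun k a ha haD => h.isIntegrableDistribution_distU hJ (isAdmissible_polyQ hJ ha)
      (qCondition_polyQ hJ ha hU (fun K _ B hB q => h.mul_mul_mem_distU hB) haD)
  have h1F : IsIntegrableDistribution (twistorSpace V) (distF S) := by
    simpa using h.isIntegrableDistribution_distF (isAdmissible_one J) (qCondition_one _)
  have h1U : IsIntegrableDistribution (twistorSpace V) (distU J S) := by
    simpa using h.isIntegrableDistribution_distU hJ (isAdmissible_one J) (qCondition_one _)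
  exact ⟨fun Q hQ => ⟨h.isIntegrableDistribution_distF hQ, h.isIntegrableDistribution_distU hJ hQ⟩,
    fun k a ha => ⟨hpF k a ha, hpU k a ha⟩, h1F, h1U, fun k a ha =>
      ⟨fun hc => hpF k a ha fun i => (hc i).annihilatedAlong (ha i) h1F,
        fun hc => hpU k a ha fun i => (hc i).annihilatedAlong (ha i) h1U⟩⟩
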